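/- Let $\mathbb X$ be a tangent category with negatives, with structure $(T,p,0,+,l,c)$. Assume that $\mathbb X$ has finite products and that $T$ preserves them; assume also that every differential bundle can be pulled back along every morphism into its base, and that $T$ preserves these pullbacks. Let $R$ be a (fibred) unit object of $\mathbb X$, that is, a differential object $R$ (a differential bundle over the terminal object, with lift $\lambda_R$) with a point $u:1\to R$ such that (i) for every object $M$, all differential bundles $V,W,E$ over $M$ and every morphism $f:V\times_M W\to E$ over $M$ there is a unique morphism $\hat f:R\times (V\times_M W)\to E$ over $M$ that is linear in $R$ and satisfies $\hat f(u,v,w)=f(v,w)$; if $f$ is linear in $W$, then so is $\hat f$. (Linear means commuting with the lifts.) For a differential bundle $\pi:A\to M$ with lift $\lambda$ and zero section $\xi$, the map $\bullet_\pi=\widehat{\mathrm{id}_A}:R\times A\to A$ is called scalar multiplication; (ii) if the differential bundle $f^*A$ is the pullback of $A$ along $f:N\to M$, then the canonical map $h:f^*A\to A$ satisfies $h(r\bullet a)=r\bullet h(a)$; (iii) $T(\bullet_\pi)(\lambda_R r, w)=\lambda(r\bullet_\pi p(w)) +_p T(\xi\pi)(w)$ for $r\in R$ and $w\in T(A)$.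 Let $(\pi:A\to M,\rho,\alpha)$ be an involution algebroid in $\mathbb X$, with lift $\lambda$ and zero section $\xi$. Thus $\pi$ is a differential bundle, the anchor $\rho:A\to T(M)$ is a linear bundle morphism over $\mathrm{id}_M$, the pullback $L=A\times_{\rho,T(\pi)}T(A)$, with projections $\pi_0,\pi_1$, exists and is preserved by $T$, and $\alpha:L\to T(A)$ is a morphism such that $(\alpha,\mathrm{id})$ is a linear bundle morphism from $\pi_0:L\to A$ (with lift $0\times cT(\lambda)$) to $p$, $(\alpha,\rho)$ is a linear bundle morphism from $p\pi_1:L\to A$ (with lift $\lambda\times l$) to $T(\pi)$ (with lift $cT(\lambda)$), and $$T(\rho)\alpha=cT(\rho)\pi_1,\qquad \alpha(\xi\pi,\lambda)=\lambda,\qquad \alpha(p\pi_1,\alpha)=\pi_1,$$ $$T(\alpha)(\alpha(v,w),z)=c\,T(\alpha)\big(\alpha(v,pz),\,c\,T(\alpha)(w,cz)\big)\quad\text{whenever } \rho v=T(\pi)w,\ cT^2(\pi)z=T(\rho)w .$$ For sections $X,Y$ of $\pi$ let $[X,Y]$ be the section determined by $$\lambda[X,Y]=\big(\alpha(X,T(Y)\rho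 X)-_p T(X)\rho Y\big)-_{T(\pi)}0X ,$$ and for $\psi:M\to R$ put $\mathcal L_{\rho X}(\psi)=\hat p\,T(\psi)\rho X$, where $\hat p:T(R)\to R$ is the map with $\hat p(0a+_{T}\lambda_R b)=b$ (here $+_T$ is the image under $T$ of the addition of $R$). Then for all sections $X,Y$ of $\pi$ and all $\psi:M\to R$ the Leibniz law $$[X,\psi\bullet_\pi Y]=\psi\bullet_\pi[X,Y]+\mathcal L_{\rho X}(\psi)\bullet_\pi Y$$ holds, and moreover $$\alpha(X,T(\psi\bullet_\pi Y)\rho X)-_{T(\pi)}\psi\bullet_p\alpha(X,T(Y)\rho X)=\lambda\big(\mathcal L_{\rho X}(\psi)\bullet_\pi Y\big)+_pT(\xi)\rho(\psi\bullet_\pi Y).$$ Here $\bullet_p$ is scalar multiplication for the differential bundle $p:T(A)\to A$. -/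

import Mathlib

open CategoryTheory CategoryTheory.Limits

universe v u

namespace TangentCat

section Additive

variable {C : Type u} [Category.{v} C]

/-- The operations of an additive bundle (with negatives) over `q : E ⟶ M`: a zero section, a
fibrewise addition `E ×_M E ⟶ E` and a fibrewise negation, all of them maps over `M`. -/
structure FibreOps {E M : C} (q : E ⟶ M) [HasPullback q q] where
  zero : M ⟶ E
  add : pullback q q ⟶ E
  neg : E ⟶ E
  zero_proj : zero ≫ q = 𝟙 M
  add_proj : add ≫ q = pullback.fst q q ≫ q
  neg_proj : neg ≫ q = q

instance hasPullback_map (F : C ⥤ C) {X Y Z : C} (f : X ⟶ Z) (g : Y ⟶ Z) [HasPullback f g]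
    [PreservesLimit (cospan f g) F] : HasPullback (F.map f) (F.map g) :=
  hasPullback_of_preservesPullback F f g

namespace FibreOps

variable {E M : C} {q : E ⟶ M} [HasPullback q q]

/-- The sum of two generalised elements in the same fibre. -/
noncomputable def plus (S : FibreOps q) {Z : C} (a b : Z ⟶ E) (h : a ≫ q = b ≫ q) : Z ⟶ E :=
  pullback.lift a b h ≫ S.add

theorem plus_proj (S : FibreOps q) {Z : C} (a b : Z ⟶ E) (h : a ≫ q = b ≫ q) :
    S.plus a b h ≫ q = a ≫ q := by
  rw [plus, Category.assoc, S.add_proj, ← Category.assoc, pullback.lift_fst]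

/-- The difference of two generalised elements in the same fibre. -/
noncomputable def minus (S : FibreOps q) {Z : C} (a b : Z ⟶ E) (h : a ≫ q = b ≫ q) : Z ⟶ E :=
  S.plus a (b ≫ S.neg) (by rw [Category.assoc, S.neg_proj, h])

/-- The image of the operations under a functor that preserves `E ×_M E`. -/
noncomputable def map (S : FibreOps q) (F : C ⥤ C) [PreservesLimit (cospan q q) F] :
    FibreOps (F.map q) where
  zero := F.map S.zero
  add :=
    ((IsPullback.of_hasPullback q q).map F).lift
      (pullback.fst (F.map q) (F.map q)) (pullback.snd (F.map q) (F.map q)) pullback.condition ≫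
        F.map S.add
  neg := F.map S.neg
  zero_proj := by rw [← F.map_comp, S.zero_proj, F.map_id]
  add_proj := by
    rw [Category.assoc, ← F.map_comp, S.add_proj, F.map_comp, IsPullback.lift_fst_assoc]
  neg_proj := by rw [← F.map_comp, S.neg_proj]

end FibreOps

/-- An additive bundle with negatives: an abelian group object in the slice over `M`; the laws are
stated on generalised elements. -/
structure AdditiveBundle {E M : C} (q : E ⟶ M) [HasPullback q q] extends FibreOps q where
  zero_plus : ∀ {Z : C} (a : Z ⟶ E),
    toFibreOps.plus (a ≫ q ≫ zero) a (by simp [zero_proj]) = a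
  plus_comm : ∀ {Z : C} (a b : Z ⟶ E) (h : a ≫ q = b ≫ q),
    toFibreOps.plus a b h = toFibreOps.plus b a h.symm
  plus_assoc : ∀ {Z : C} (a b d : Z ⟶ E) (h : a ≫ q = b ≫ q) (h' : b ≫ q = d ≫ q),
    toFibreOps.plus (toFibreOps.plus a b h) d
        (by rw [toFibreOps.plus_proj, h, h']) =
      toFibreOps.plus a (toFibreOps.plus b d h') (by rw [toFibreOps.plus_proj, h])
  neg_plus : ∀ {Z : C} (a : Z ⟶ E),
    toFibreOps.plus (a ≫ neg) a (by simp [neg_proj]) = a ≫ q ≫ zero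

/-- `(φ, f)` is a morphism of bundles that preserves zero and addition in the fibres. -/
structure IsAdditiveHom {E M E' M' : C} {q : E ⟶ M} {q' : E' ⟶ M'} [HasPullback q q] [HasPullback q' q'] (S : FibreOps q)
    (S' : FibreOps q') (φ : E ⟶ E') (f : M ⟶ M') : Prop where
  w : φ ≫ q' = q ≫ f
  map_zero : S.zero ≫ φ = f ≫ S'.zero
  map_add : S.add ≫ φ = pullback.map q q q' q' φ φ f w.symm w.symm ≫ S'.add

theorem FibreOps.plus_congr {E M : C} {q : E ⟶ M} [HasPullback q q] (S : FibreOps q) {Z : C}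
    {a b a' b' : Z ⟶ E} (ha : a = a') (hb : b = b') (h : a ≫ q = b ≫ q) :
    S.plus a b h = S.plus a' b' (by rw [← ha, ← hb, h]) := by
  subst ha hb; rfl

theorem AdditiveBundle.minus_self {E M : C} {q : E ⟶ M} [HasPullback q q] (S : AdditiveBundle q)
    {Z : C} (a : Z ⟶ E) : S.minus a a rfl = a ≫ q ≫ S.zero := by
  rw [FibreOps.minus, S.plus_comm, S.neg_plus]

theorem FibreOps.minus_proj {E M : C} {q : E ⟶ M} [HasPullback q q] (S : FibreOps q) {Z : C} (a b : Z ⟶ E)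
    (h : a ≫ q = b ≫ q) : S.minus a b h ≫ q = a ≫ q := S.plus_proj _ _ _

theorem FibreOps.comp_plus {E M : C} {q : E ⟶ M} [HasPullback q q] (S : FibreOps q) {Z W : C} (g : W ⟶ Z)
    (a b : Z ⟶ E) (h : a ≫ q = b ≫ q) :
    g ≫ S.plus a b h = S.plus (g ≫ a) (g ≫ b) (by simp [h]) := by
  unfold FibreOps.plus
  rw [← Category.assoc]
  congr 1
  apply pullback.hom_ext <;> simp [pullback.lift_fst, pullback.lift_snd]

theorem IsAdditiveHom.plus {E M E' M' : C} {q : E ⟶ M} {q' : E' ⟶ M'} [HasPullback q q]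
    [HasPullback q' q'] {S : FibreOps q} {S' : FibreOps q'} {φ : E ⟶ E'} {f : M ⟶ M'} (H : IsAdditiveHom S S' φ f) {Z : C}
    (a b : Z ⟶ E) (h : a ≫ q = b ≫ q) :
    S.plus a b h ≫ φ = S'.plus (a ≫ φ) (b ≫ φ)
      (by rw [Category.assoc, Category.assoc, H.w, ← Category.assoc, h, Category.assoc]) := by
  unfold FibreOps.plus
  rw [Category.assoc, H.map_add, ← Category.assoc]
  congr 1
  apply pullback.hom_ext <;>
    simp [pullback.lift_fst, pullback.lift_snd, pullback.lift_fst_assoc, pullback.lift_snd_assoc, pullback.map]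

theorem FibreOps.map_plus {E M : C} {q : E ⟶ M} [HasPullback q q] (S : FibreOps q) (F : C ⥤ C)
    [PreservesLimit (cospan q q) F] {Z : C} (a b : Z ⟶ F.obj E) (h : a ≫ F.map q = b ≫ F.map q) :
    (S.map F).plus a b h =
      ((IsPullback.of_hasPullback q q).map F).lift a b h ≫ F.map S.add := by
  have H := (IsPullback.of_hasPullback q q).map F
  have e : pullback.lift a b h ≫ H.lift (pullback.fst (F.map q) (F.map q))
      (pullback.snd (F.map q) (F.map q)) pullback.condition = H.lift a b h := by
    apply H.hom_ext <;> simp [pullback.lift_fst, pullback.lift_snd]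
  rw [← e, Category.assoc]; rfl

theorem IsAdditiveHom.comp {E M E' M' E'' M'' : C} {q : E ⟶ M} {q' : E' ⟶ M'} {q'' : E'' ⟶ M''}
    [HasPullback q q] [HasPullback q' q'] [HasPullback q'' q''] {S : FibreOps q}
    {S' : FibreOps q'} {S'' : FibreOps q''} {φ : E ⟶ E'} {f : M ⟶ M'} {ψ : E' ⟶ E''} {g : M' ⟶ M''}
    (H : IsAdditiveHom S S' φ f) (K : IsAdditiveHom S' S'' ψ g) :
    IsAdditiveHom S S'' (φ ≫ ψ) (f ≫ g) where
  w := by rw [Category.assoc, K.w, ← Category.assoc, H.w, Category.assoc]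
  map_zero := by rw [← Category.assoc, H.map_zero, Category.assoc, K.map_zero, Category.assoc]
  map_add := by
    rw [← Category.assoc, H.map_add, Category.assoc, K.map_add, ← Category.assoc]
    congr 1
    apply pullback.hom_ext <;>
      simp [pullback.lift_fst, pullback.lift_snd, pullback.lift_fst_assoc, pullback.lift_snd_assoc,
        pullback.map]

end Additive

/-- The data and the equational axioms of a tangent category with negatives. Composition is written
in diagrammatic order. -/
class PreTangentCategory (C : Type u) [Category.{v} C] where
  /-- the tangent functor -/
  T : C ⥤ C
  /-- the projections, the zero sections, the vertical lifts and the canonical flips -/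
  p : ∀ M : C, T.obj M ⟶ M
  zero : ∀ M : C, M ⟶ T.obj M
  l : ∀ M : C, T.obj M ⟶ T.obj (T.obj M)
  c : ∀ M : C, T.obj (T.obj M) ⟶ T.obj (T.obj M)
  p_naturality : ∀ {M N : C} (f : M ⟶ N), T.map f ≫ p N = p M ≫ f
  zero_naturality : ∀ {M N : C} (f : M ⟶ N), f ≫ zero N = zero M ≫ T.map f
  l_naturality : ∀ {M N : C} (f : M ⟶ N), T.map f ≫ l N = l M ≫ T.map (T.map f)
  c_naturality : ∀ {M N : C} (f : M ⟶ N), T.map (T.map f) ≫ c N = c M ≫ T.map (T.map f)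
  /-- all pullback powers of `p` exist and are preserved by `T` -/
  hasPowers : ∀ (M : C) (n : ℕ), HasWidePullback M (fun _ : Fin n => T.obj M) (fun _ => p M)
  preservesPowers : ∀ (M : C) (n : ℕ),
    PreservesLimit (WidePullbackShape.wideCospan M (fun _ : Fin n => T.obj M) (fun _ => p M)) T
  [hasSquare : ∀ M : C, HasPullback (p M) (p M)]
  [preservesSquare : ∀ M : C, PreservesLimit (cospan (p M) (p M)) T]
  /-- `p M` is an additive bundle with zero section `zero M` -/
  bundle : ∀ M : C, AdditiveBundle (p M)
  bundle_zero : ∀ M : C, (bundle M).zero = zero M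
  /-- naturality of the addition -/
  bundle_naturality : ∀ {M N : C} (f : M ⟶ N),
    IsAdditiveHom (bundle M).toFibreOps (bundle N).toFibreOps (T.map f) f
  c_c : ∀ M : C, c M ≫ c M = 𝟙 _
  c_braid : ∀ M : C, T.map (c M) ≫ c (T.obj M) ≫ T.map (c M) =
    c (T.obj M) ≫ T.map (c M) ≫ c (T.obj M)
  l_c : ∀ M : C, l M ≫ c M = l M
  l_l : ∀ M : C, l M ≫ T.map (l M) = l M ≫ l (T.obj M)
  l_c_c : ∀ M : C, l (T.obj M) ≫ T.map (c M) ≫ c (T.obj M) = c M ≫ T.map (l M)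
  /-- `(l, 0) : p ⇒ T(p)` and `(c, id) : T(p) ⇒ p` are additive bundle morphisms -/
  l_additive : ∀ M : C,
    IsAdditiveHom (bundle M).toFibreOps ((bundle M).toFibreOps.map T) (l M) (zero M)
  c_additive : ∀ M : C,
    IsAdditiveHom ((bundle M).toFibreOps.map T) (bundle (T.obj M)).toFibreOps (c M) (𝟙 _)

section PreTangent

open PreTangentCategory

variable {C : Type u} [Category.{v} C] [PreTangentCategory C]

attribute [instance] hasSquare preservesSquare

/-- The fibrewise operations of the tangent bundle of `M`. -/
abbrev tOps (M : C) : FibreOps (p M) := (bundle M).toFibreOps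

theorem zero_p (M : C) : zero M ≫ p M = 𝟙 M := by
  rw [← bundle_zero]; exact (bundle M).zero_proj

theorem l_Tp (M : C) : l M ≫ T.map (p M) = p M ≫ zero M := (l_additive M).w

theorem c_p (M : C) : c M ≫ p (T.obj M) = T.map (p M) := by
  simpa using (c_additive M).w

theorem c_Tp (M : C) : c M ≫ T.map (p M) = p (T.obj M) := by
  rw [← c_p, ← Category.assoc, c_c, Category.id_comp]

theorem l_p (M : C) : l M ≫ p (T.obj M) = p M ≫ zero M := by
  rw [← l_c, Category.assoc, c_p, l_Tp]

theorem l_zero (M : C) : zero M ≫ l M = zero M ≫ zero (T.obj M) := by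
  have h := (l_additive M).map_zero
  rw [bundle_zero] at h
  rw [h, zero_naturality, ← bundle_zero]
  rfl

theorem T_zero_c (M : C) : T.map (zero M) ≫ c M = zero (T.obj M) := by
  have h := (c_additive M).map_zero
  rw [Category.id_comp, bundle_zero] at h
  rw [← h]
  change _ = T.map (bundle M).zero ≫ c M
  rw [bundle_zero]

/-- The projection is additive from the image of a bundle under `T` to the bundle. -/
theorem map_plus_p {E M : C} {q : E ⟶ M} [HasPullback q q] (S : FibreOps q) [PreservesLimit (cospan q q) (T : C ⥤ C)]
    {Z : C} (a b : Z ⟶ T.obj E) (h : a ≫ T.map q = b ≫ T.map q) :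
    (S.map T).plus a b h ≫ p E = S.plus (a ≫ p E) (b ≫ p E)
      (by simp only [Category.assoc, ← p_naturality]; rw [← Category.assoc, h, Category.assoc]) := by
  rw [FibreOps.map_plus, Category.assoc, p_naturality, ← Category.assoc, FibreOps.plus]
  congr 1
  apply pullback.hom_ext
  · rw [Category.assoc, ← p_naturality, IsPullback.lift_fst_assoc, pullback.lift_fst]
  · rw [Category.assoc, ← p_naturality, IsPullback.lift_snd_assoc, pullback.lift_snd]

theorem tOps_minus_map {E M : C} (f : E ⟶ M) {Z : C} (a b : Z ⟶ T.obj E)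
    (hp : a ≫ p E = b ≫ p E) (hT : a ≫ T.map f = b ≫ T.map f) :
    (tOps E).minus a b hp ≫ T.map f = b ≫ p E ≫ f ≫ zero M := by
  have H := bundle_naturality f
  have e : (tOps E).minus a b hp ≫ T.map f = (tOps E).minus b b rfl ≫ T.map f := by
    unfold FibreOps.minus
    rw [H.plus, H.plus]
    exact FibreOps.plus_congr _ hT rfl _
  rw [e, (bundle E).minus_self, bundle_zero, Category.assoc, Category.assoc, ← zero_naturality]

/-- `μ(a, b) = 0b + la`, the sum being taken with `T(+)`. -/
noncomputable def tangentMu (M : C) : pullback (p M) (p M) ⟶ T.obj (T.obj M) :=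
  ((tOps M).map T).plus (pullback.snd _ _ ≫ zero (T.obj M)) (pullback.fst _ _ ≫ l M) (by
    rw [Category.assoc, Category.assoc, ← zero_naturality, l_Tp, ← Category.assoc,
      ← Category.assoc, pullback.condition])

theorem tangentMu_condition (M : C) :
    tangentMu M ≫ T.map (p M) = tangentMu M ≫ p (T.obj M) ≫ p M ≫ zero M := by
  have h : tangentMu M ≫ T.map (p M) = pullback.snd _ _ ≫ p M ≫ zero M := by
    unfold tangentMu
    rw [FibreOps.plus_proj, Category.assoc, zero_naturality]
  have h2 : tangentMu M ≫ p (T.obj M) ≫ p M = pullback.snd _ _ ≫ p M := by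
    rw [← p_naturality, ← Category.assoc, h]
    simp [zero_p]
  rw [h, ← Category.assoc (p (T.obj M)), ← Category.assoc (tangentMu M), h2, Category.assoc]

end PreTangent

/-- A tangent category (with negatives): the vertical lift is moreover universal. -/
class TangentCategory (C : Type u) [Category.{v} C] extends PreTangentCategory C where
  universal : ∀ M : C, Nonempty (IsLimit (Fork.ofι (tangentMu M) (tangentMu_condition M)))

section Bundles

open PreTangentCategory

variable {C : Type u} [Category.{v} C] [TangentCategory C]

/-- The data and the equational axioms of a differential bundle over `M`. -/
structure PreDifferentialBundle (M : C) where
  E : C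
  proj : E ⟶ M
  [hasSquare : HasPullback proj proj]
  bundle : AdditiveBundle proj
  [preservesSquare : PreservesLimit (cospan proj proj) (T : C ⥤ C)]
  lift : E ⟶ T.obj E
  /-- `(λ, 0)` and `(λ, ξ)` are additive bundle morphisms -/
  lift_additive : IsAdditiveHom bundle.toFibreOps (bundle.toFibreOps.map T) lift
    (PreTangentCategory.zero M)
  lift_additive' : IsAdditiveHom bundle.toFibreOps (tOps E) lift bundle.zero
  lift_lift : lift ≫ T.map lift = lift ≫ l E

attribute [instance] PreDifferentialBundle.hasSquare PreDifferentialBundle.preservesSquare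

namespace PreDifferentialBundle

variable {M : C} (A : PreDifferentialBundle M)

/-- The fibrewise operations of the bundle. -/
abbrev ops : FibreOps A.proj := A.bundle.toFibreOps

/-- The fibrewise operations of `T(π) : T(A) ⟶ T(M)`. -/
noncomputable abbrev Tops : FibreOps ((T : C ⥤ C).map A.proj) := A.ops.map T

/-- The zero section `ξ`. -/
abbrev ξ : M ⟶ A.E := A.bundle.zero

theorem lift_Tproj : A.lift ≫ T.map A.proj = A.proj ≫ PreTangentCategory.zero M :=
  A.lift_additive.w

theorem ξ_lift : A.ξ ≫ A.lift = A.ξ ≫ PreTangentCategory.zero A.E := by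
  rw [zero_naturality]
  exact A.lift_additive.map_zero

theorem lift_p : A.lift ≫ p A.E = A.proj ≫ A.ξ := A.lift_additive'.w

theorem ξ_proj : A.ξ ≫ A.proj = 𝟙 M := A.bundle.zero_proj

/-- `μ(a, b) = 0a + λb`, the sum being taken with `T(+)`. -/
noncomputable def mu : pullback A.proj A.proj ⟶ T.obj A.E :=
  A.Tops.plus (pullback.fst _ _ ≫ PreTangentCategory.zero A.E) (pullback.snd _ _ ≫ A.lift) (by
    rw [Category.assoc, Category.assoc, ← zero_naturality, A.lift_Tproj, ← Category.assoc,
      ← Category.assoc, pullback.condition])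

theorem mu_Tproj : A.mu ≫ T.map A.proj = pullback.fst _ _ ≫ A.proj ≫ PreTangentCategory.zero M := by
  unfold mu
  rw [FibreOps.plus_proj, Category.assoc, zero_naturality]

theorem mu_condition :
    A.mu ≫ T.map A.proj = A.mu ≫ p A.E ≫ A.proj ≫ PreTangentCategory.zero M := by
  have h2 : A.mu ≫ p A.E ≫ A.proj = pullback.fst _ _ ≫ A.proj := by
    rw [← p_naturality, ← Category.assoc, mu_Tproj]
    simp [zero_p]
  rw [mu_Tproj, ← Category.assoc (p A.E), ← Category.assoc A.mu, h2, Category.assoc]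

theorem mu_p : A.mu ≫ p A.E = pullback.fst _ _ := by
  unfold mu
  rw [map_plus_p]
  have h1 : (pullback.fst A.proj A.proj ≫ PreTangentCategory.zero A.E) ≫ p A.E =
      pullback.fst _ _ := by simp [zero_p]
  have h2 : (pullback.snd A.proj A.proj ≫ A.lift) ≫ p A.E =
      pullback.fst A.proj A.proj ≫ A.proj ≫ A.ξ := by
    rw [Category.assoc, A.lift_p, ← Category.assoc, ← pullback.condition, Category.assoc]
  have := A.bundle.plus_comm (pullback.fst A.proj A.proj)
    (pullback.fst A.proj A.proj ≫ A.proj ≫ A.ξ) (by simp [A.ξ_proj])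
  rw [A.bundle.zero_plus] at this
  simpa only [h1, h2] using this

end PreDifferentialBundle

/-- A differential bundle over `M`: the lift is moreover universal. -/
structure DifferentialBundle (M : C) extends PreDifferentialBundle M where
  universal :
    Nonempty (IsLimit (Fork.ofι toPreDifferentialBundle.mu toPreDifferentialBundle.mu_condition))

/-- A linear differential bundle morphism `(φ, f) : A ⇒ B`. -/
structure IsLinearHom {M N : C} (A : DifferentialBundle M) (B : DifferentialBundle N)
    (φ : A.E ⟶ B.E) (f : M ⟶ N) : Prop where
  w : φ ≫ B.proj = A.proj ≫ f
  lift : φ ≫ B.lift = A.lift ≫ T.map φ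

/-- The tangent bundle `p : T(M) ⟶ M` as a differential bundle, with lift `l`. -/
noncomputable def tangentBundle (M : C) : DifferentialBundle M where
  E := T.obj M
  proj := p M
  bundle := PreTangentCategory.bundle M
  lift := l M
  lift_additive := l_additive M
  lift_additive' := by
    have := (l_additive M).comp (c_additive M)
    rw [l_c, Category.comp_id] at this
    rw [bundle_zero]
    exact this
  lift_lift := l_l M
  universal := by
    obtain ⟨h⟩ := TangentCategory.universal M
    refine ⟨h.ofIsoLimit (Fork.ext (pullbackSymmetry (p M) (p M)) ?_)⟩
    change (pullbackSymmetry (p M) (p M)).hom ≫ ((tOps M).map T).plus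
      (pullback.fst _ _ ≫ PreTangentCategory.zero (T.obj M)) (pullback.snd _ _ ≫ l M) _ =
        ((tOps M).map T).plus (pullback.snd _ _ ≫ PreTangentCategory.zero (T.obj M))
          (pullback.fst _ _ ≫ l M) _
    rw [FibreOps.comp_plus]
    congr 1 <;> simp [← Category.assoc]

/-- The trivial bundle `id : M ⟶ M`, without the universality of its lift. -/
noncomputable def trivialPreBundle (M : C) : PreDifferentialBundle M where
  E := M
  proj := 𝟙 M
  bundle :=
    { zero := 𝟙 M
      add := pullback.fst _ _
      neg := 𝟙 M
      zero_proj := by simp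
      add_proj := rfl
      neg_proj := by simp
      zero_plus := by intros; simp [FibreOps.plus, pullback.lift_fst]
      plus_comm := by intro Z a b h; simpa [FibreOps.plus, pullback.lift_fst] using h
      plus_assoc := by intros; simp [FibreOps.plus, pullback.lift_fst]
      neg_plus := by intros; simp [FibreOps.plus, pullback.lift_fst] }
  lift := PreTangentCategory.zero M
  lift_additive :=
    { w := by simp
      map_zero := by simp [FibreOps.map]
      map_add := by
        simp only [FibreOps.map]
        rw [IsPullback.lift_fst]
        simp [pullback.map, pullback.lift_fst] }
  lift_additive' :=
    { w := by simp [zero_p]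
      map_zero := by simp [bundle_zero]
      map_add := by
        have h := (bundle M).zero_plus (pullback.fst (𝟙 M) (𝟙 M) ≫ PreTangentCategory.zero M)
        have e : pullback.fst (𝟙 M) (𝟙 M) = pullback.snd (𝟙 M) (𝟙 M) := by
          simpa using pullback.condition (f := 𝟙 M) (g := 𝟙 M)
        rw [← h]
        unfold FibreOps.plus
        congr 1
        apply pullback.hom_ext
        · simp only [pullback.map, pullback.lift_fst, Category.assoc]
          rw [← Category.assoc (PreTangentCategory.zero M), zero_p, Category.id_comp, bundle_zero]
        · simp only [pullback.map, pullback.lift_snd, e] }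
  lift_lift := by
    rw [← zero_naturality, ← l_zero]
theorem trivialPreBundle_mu (M : C) : (trivialPreBundle M).mu =
    pullback.fst (𝟙 M) (𝟙 M) ≫ PreTangentCategory.zero M := by
  unfold PreDifferentialBundle.mu
  rw [FibreOps.map_plus]
  exact IsPullback.lift_fst _ _ _ _

/-- The trivial differential bundle `id : M ⟶ M`. -/
noncomputable def trivialBundle (M : C) : DifferentialBundle M where
  toPreDifferentialBundle := trivialPreBundle M
  universal := by
    have e : pullback.fst (𝟙 M) (𝟙 M) = pullback.snd (𝟙 M) (𝟙 M) := by
      simpa using pullback.condition (f := 𝟙 M) (g := 𝟙 M)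
    refine ⟨Fork.IsLimit.mk _ (fun s => pullback.lift (s.ι ≫ p M) (s.ι ≫ p M) rfl) ?_ ?_⟩
    · intro s
      have h : s.ι ≫ T.map (𝟙 M) = s.ι ≫ p M ≫ 𝟙 M ≫ PreTangentCategory.zero M := s.condition
      have h' : s.ι = s.ι ≫ p M ≫ PreTangentCategory.zero M :=
        (Category.comp_id _).symm.trans ((congrArg (s.ι ≫ ·) (T.map_id M).symm).trans
          (h.trans (congrArg (fun x => s.ι ≫ p M ≫ x) (Category.id_comp _))))
      refine Eq.trans (congrArg (_ ≫ ·) (trivialPreBundle_mu M)) ?_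
      refine Eq.trans (Category.assoc _ _ _).symm ?_
      refine Eq.trans (congrArg (· ≫ PreTangentCategory.zero M) 
        (pullback.lift_fst (f := 𝟙 M) (g := 𝟙 M) (s.ι ≫ p M) (s.ι ≫ p M) rfl)) ?_
      exact (Category.assoc _ _ _).trans h'.symm
    · intro s m hm
      have h1 : m ≫ pullback.fst (𝟙 M) (𝟙 M) = s.ι ≫ p M := by
        rw [← hm]
        refine Eq.trans ?_ (Category.assoc _ _ _).symm
        exact (congrArg (m ≫ ·) (PreDifferentialBundle.mu_p _)).symm
      apply pullback.hom_ext
      · rw [pullback.lift_fst]; exact h1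
      · rw [pullback.lift_snd]; exact (congrArg (m ≫ ·) e).symm.trans h1

/-- In a tangent category *with substitution*, differential bundles can be pulled back along
arbitrary maps, and `T` preserves these pullbacks. -/
class HasSubstitution (C : Type u) [Category.{v} C] [TangentCategory C] : Prop where
  hasPullback : ∀ {M N : C} (A : DifferentialBundle M) (f : N ⟶ M), HasPullback A.proj f
  preserves : ∀ {M N : C} (A : DifferentialBundle M) (f : N ⟶ M),
    PreservesLimit (cospan A.proj f) (T : C ⥤ C)

attribute [instance] HasSubstitution.hasPullback HasSubstitution.preserves


/-! Sections and the strong difference -/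

variable {M : C}

/-- A section of the bundle `A`. -/
structure Sec (A : DifferentialBundle M) where
  map : M ⟶ A.E
  w : map ≫ A.proj = 𝟙 M

/-- The fibrewise sum of two sections. -/
noncomputable instance (A : DifferentialBundle M) : Add (Sec A) where
  add X Y := ⟨A.ops.plus X.map Y.map (by rw [X.w, Y.w]), by rw [FibreOps.plus_proj, X.w]⟩

namespace DifferentialBundle

variable (A : DifferentialBundle M)

/-- The unique generalised element `y` of `E ×_M E` with `μ(y) = x`. -/
noncomputable def decompose {Z : C} (x : Z ⟶ T.obj A.E)
    (h : x ≫ T.map A.proj = x ≫ p A.E ≫ A.proj ≫ PreTangentCategory.zero M) :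
    Z ⟶ pullback A.proj A.proj :=
  Fork.IsLimit.lift A.universal.some x h

theorem decompose_mu {Z : C} (x : Z ⟶ T.obj A.E)
    (h : x ≫ T.map A.proj = x ≫ p A.E ≫ A.proj ≫ PreTangentCategory.zero M) :
    A.decompose x h ≫ A.mu = x :=
  Fork.IsLimit.lift_ι A.universal.some

/-- The vertical part of `x`: if `x = μ(a, b)`, this is `b`. If moreover `p(x) = ξ`, it is the
unique `b` with `λ(b) = x`. -/
noncomputable def verticalPart {Z : C} (x : Z ⟶ T.obj A.E)
    (h : x ≫ T.map A.proj = x ≫ p A.E ≫ A.proj ≫ PreTangentCategory.zero M) : Z ⟶ A.E :=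
  A.decompose x h ≫ pullback.snd _ _

/-- `(a -_p b) -_{T(π)} 0 p b`, for `a, b` in `T(A)` with `p(a) = p(b)` and `T(π)(a) = T(π)(b)`. -/
noncomputable def rawDiff {Z : C} (a b : Z ⟶ T.obj A.E) (hp : a ≫ p A.E = b ≫ p A.E)
    (hT : a ≫ T.map A.proj = b ≫ T.map A.proj) : Z ⟶ T.obj A.E :=
  A.Tops.minus ((tOps A.E).minus a b hp) (b ≫ p A.E ≫ PreTangentCategory.zero A.E) (by
    rw [tOps_minus_map _ _ _ _ hT, Category.assoc, Category.assoc, ← zero_naturality])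

theorem rawDiff_p {Z : C} (a b : Z ⟶ T.obj A.E) (hp : a ≫ p A.E = b ≫ p A.E)
    (hT : a ≫ T.map A.proj = b ≫ T.map A.proj) :
    A.rawDiff a b hp hT ≫ p A.E = b ≫ p A.E ≫ A.proj ≫ A.ξ := by
  unfold rawDiff FibreOps.minus
  rw [map_plus_p]
  have e1 : (tOps A.E).plus a (b ≫ (tOps A.E).neg) (by rw [Category.assoc, (tOps A.E).neg_proj, hp])
      ≫ p A.E = b ≫ p A.E := by rw [FibreOps.plus_proj, hp]
  have e2 : ((b ≫ p A.E ≫ PreTangentCategory.zero A.E) ≫ A.Tops.neg) ≫ p A.E =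
      (b ≫ p A.E) ≫ A.ops.neg := by
    change ((b ≫ p A.E ≫ PreTangentCategory.zero A.E) ≫ T.map A.ops.neg) ≫ p A.E = _
    simp only [Category.assoc, p_naturality]
    rw [← Category.assoc (PreTangentCategory.zero A.E), zero_p, Category.id_comp]
  rw [FibreOps.plus_congr _ e1 e2]
  refine (A.bundle.minus_self (b ≫ p A.E)).trans ?_
  rw [Category.assoc]

theorem rawDiff_Tproj {Z : C} (a b : Z ⟶ T.obj A.E) (hp : a ≫ p A.E = b ≫ p A.E)
    (hT : a ≫ T.map A.proj = b ≫ T.map A.proj) :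
    A.rawDiff a b hp hT ≫ T.map A.proj =
      A.rawDiff a b hp hT ≫ p A.E ≫ A.proj ≫ PreTangentCategory.zero M := by
  rw [← Category.assoc (A.rawDiff a b hp hT) (p A.E), rawDiff_p]
  simp only [Category.assoc]
  rw [← Category.assoc A.ξ, A.ξ_proj, Category.id_comp]
  unfold rawDiff
  rw [FibreOps.minus_proj, tOps_minus_map _ _ _ _ hT]

/-- The strong difference of `a` and `b` in `T(A)`: the unique element `d` of `A` with
`λ(d) = (a -_p b) -_{T(π)} 0 p b`. -/
noncomputable def strongDiff {Z : C} (a b : Z ⟶ T.obj A.E) (hp : a ≫ p A.E = b ≫ p A.E)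
    (hT : a ≫ T.map A.proj = b ≫ T.map A.proj) : Z ⟶ A.E :=
  A.verticalPart (A.rawDiff a b hp hT) (A.rawDiff_Tproj a b hp hT)

theorem strongDiff_lift {Z : C} (a b : Z ⟶ T.obj A.E) (hp : a ≫ p A.E = b ≫ p A.E)
    (hT : a ≫ T.map A.proj = b ≫ T.map A.proj) :
    A.strongDiff a b hp hT ≫ A.lift = A.rawDiff a b hp hT := by
  have h := A.decompose_mu _ (A.rawDiff_Tproj a b hp hT)
  have h1 : A.decompose _ (A.rawDiff_Tproj a b hp hT) ≫ pullback.fst _ _ =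
      b ≫ p A.E ≫ A.proj ≫ A.ξ := by
    rw [← A.mu_p, ← Category.assoc, h, rawDiff_p]
  rw [← h, PreDifferentialBundle.mu, FibreOps.comp_plus]
  set d := A.decompose _ (A.rawDiff_Tproj a b hp hT) with hd
  have hq : d ≫ pullback.snd _ _ ≫ A.proj = b ≫ p A.E ≫ A.proj := by
    rw [← pullback.condition, ← Category.assoc, h1]
    simp only [Category.assoc, A.ξ_proj, Category.comp_id]
  have e1 : d ≫ pullback.fst _ _ ≫ PreTangentCategory.zero A.E =
      (d ≫ pullback.snd _ _ ≫ A.proj ≫ PreTangentCategory.zero M) ≫ A.Tops.zero := by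
    rw [← Category.assoc, h1]
    have := congrArg (· ≫ PreTangentCategory.zero M ≫ T.map A.ξ) hq
    simp only [Category.assoc] at this ⊢
    change _ = d ≫ pullback.snd _ _ ≫ A.proj ≫ PreTangentCategory.zero M ≫ T.map A.ξ
    rw [this, zero_naturality]
  have key : ∀ x : Z ⟶ T.obj A.E, ∀ h', A.Tops.plus (x ≫ T.map A.proj ≫ A.Tops.zero) x h' = x := by
    intro x h'
    have hu := congrArg T.map (A.bundle.zero_plus (𝟙 A.E))
    rw [T.map_id, FibreOps.plus, T.map_comp] at hu
    rw [FibreOps.map_plus]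
    have e : ((IsPullback.of_hasPullback A.proj A.proj).map T).lift
        (x ≫ T.map A.proj ≫ A.Tops.zero) x h' = x ≫ T.map (pullback.lift
          (𝟙 A.E ≫ A.proj ≫ A.bundle.zero) (𝟙 A.E) (by simp [A.bundle.zero_proj])) := by
      apply ((IsPullback.of_hasPullback A.proj A.proj).map T).hom_ext
      · rw [IsPullback.lift_fst, Category.assoc, ← T.map_comp, pullback.lift_fst, Category.id_comp,
          T.map_comp]
        rfl
      · rw [IsPullback.lift_snd, Category.assoc, ← T.map_comp, pullback.lift_snd, T.map_id,
          Category.comp_id]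
    rw [e, Category.assoc, hu, Category.comp_id]
  have e2 : (d ≫ pullback.snd _ _ ≫ A.proj ≫ PreTangentCategory.zero M) ≫ A.Tops.zero =
      (d ≫ pullback.snd _ _ ≫ A.lift) ≫ T.map A.proj ≫ A.Tops.zero := by
    simp only [Category.assoc]
    rw [← Category.assoc A.lift, A.lift_Tproj, Category.assoc]
  rw [FibreOps.plus_congr _ (e1.trans e2) rfl, key]
  simp only [strongDiff, verticalPart, Category.assoc]
  rfl

theorem strongDiff_proj {Z : C} (a b : Z ⟶ T.obj A.E) (hp : a ≫ p A.E = b ≫ p A.E)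
    (hT : a ≫ T.map A.proj = b ≫ T.map A.proj) :
    A.strongDiff a b hp hT ≫ A.proj = b ≫ p A.E ≫ A.proj := by
  have h1 : A.decompose _ (A.rawDiff_Tproj a b hp hT) ≫ pullback.fst _ _ =
      b ≫ p A.E ≫ A.proj ≫ A.ξ := by
    rw [← A.mu_p, ← Category.assoc, A.decompose_mu, rawDiff_p]
  rw [strongDiff, verticalPart, Category.assoc, ← pullback.condition, ← Category.assoc, h1]
  simp only [Category.assoc, A.ξ_proj, Category.comp_id]

end DifferentialBundle

/-! Anchored bundles and involution algebroids -/

/-- An anchored bundle over `M`: a differential bundle `π : A ⟶ M` with a linear bundle morphism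
`ρ : A ⇒ T(M)` over the identity. -/
structure AnchoredBundle (M : C) extends DifferentialBundle M where
  ρ : E ⟶ T.obj M
  ρ_linear : IsLinearHom toDifferentialBundle (tangentBundle M) ρ (𝟙 M)

namespace AnchoredBundle

variable (A : AnchoredBundle M)

theorem ρ_p : A.ρ ≫ p M = A.proj := by
  have := A.ρ_linear.w
  rwa [Category.comp_id] at this

theorem ρ_l : A.ρ ≫ l M = A.lift ≫ T.map A.ρ := A.ρ_linear.lift

theorem ξ_ρ : A.ξ ≫ A.ρ = PreTangentCategory.zero M := by
  have h : A.ξ ≫ A.ρ ≫ l M = A.ξ ≫ A.ρ ≫ PreTangentCategory.zero (T.obj M) := by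
    rw [A.ρ_l, ← Category.assoc, A.ξ_lift, Category.assoc, zero_naturality]
  have h2 := congrArg (· ≫ p (T.obj M)) h
  simp only [Category.assoc, zero_p, l_p, Category.comp_id] at h2
  rw [← h2, ← Category.assoc A.ρ, A.ρ_p, ← Category.assoc, A.ξ_proj, Category.id_comp]

variable [HasPullback A.ρ (T.map A.proj)] [PreservesLimit (cospan A.ρ (T.map A.proj)) (T : C ⥤ C)]

/-- The generalised element `(x, y)` of the image under `T` of the prolongation. -/
noncomputable def prolT {Z : C} (x : Z ⟶ T.obj A.E) (y : Z ⟶ T.obj (T.obj A.E))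
    (h : x ≫ T.map A.ρ = y ≫ T.map (T.map A.proj)) :
    Z ⟶ T.obj (pullback A.ρ (T.map A.proj)) :=
  ((IsPullback.of_hasPullback A.ρ (T.map A.proj)).map T).lift x y h

/-- The lift `0 × cT(λ)` of the bundle `π₀` on the prolongation. -/
noncomputable def prolLift₀ :
    pullback A.ρ (T.map A.proj) ⟶ T.obj (pullback A.ρ (T.map A.proj)) :=
  A.prolT (pullback.fst _ _ ≫ PreTangentCategory.zero A.E)
    (pullback.snd _ _ ≫ T.map A.lift ≫ c A.E) (by
      simp only [Category.assoc]
      rw [← zero_naturality, ← c_naturality, ← Category.assoc (T.map A.lift), ← T.map_comp,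
        A.lift_Tproj, T.map_comp, Category.assoc, T_zero_c, ← Category.assoc,
        pullback.condition, Category.assoc])

/-- The lift `λ × l` of the bundle `pπ₁` on the prolongation. -/
noncomputable def prolLift₁ :
    pullback A.ρ (T.map A.proj) ⟶ T.obj (pullback A.ρ (T.map A.proj)) :=
  A.prolT (pullback.fst _ _ ≫ A.lift) (pullback.snd _ _ ≫ l A.E) (by
    rw [Category.assoc, Category.assoc, ← A.ρ_l, ← l_naturality, ← Category.assoc,
      ← Category.assoc, pullback.condition])

end AnchoredBundle

/-- The part of the structure of an involution algebroid that is needed to write down the remaining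
axioms. The prolongation of `A` is the pullback of `ρ` along `T(π)`; it exists and is preserved by
`T`. -/
structure PreInvolutionAlgebroid (M : C) extends AnchoredBundle M where
  [hasProlongation : HasPullback ρ (T.map proj)]
  [preservesProlongation : PreservesLimit (cospan ρ (T.map proj)) (T : C ⥤ C)]
  α : pullback ρ (T.map proj) ⟶ T.obj E
  /-- `(α, id)` is a linear bundle morphism from `π₀` to `p` -/
  α_p : α ≫ p E = pullback.fst _ _
  α_l : α ≫ l E = toAnchoredBundle.prolLift₀ ≫ T.map α
  /-- `(α, ρ)` is a linear bundle morphism from `pπ₁` to `T(π)`, whose lift is `cT(λ)` -/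
  α_Tproj : α ≫ T.map proj = pullback.snd _ _ ≫ p E ≫ ρ
  α_c : α ≫ T.map lift ≫ c E = toAnchoredBundle.prolLift₁ ≫ T.map α
  /-- target axiom -/
  target : α ≫ T.map ρ = pullback.snd _ _ ≫ T.map ρ ≫ c M

attribute [instance] PreInvolutionAlgebroid.hasProlongation
  PreInvolutionAlgebroid.preservesProlongation

namespace PreInvolutionAlgebroid

variable (A : PreInvolutionAlgebroid M)

/-- `α(v, w)` for generalised elements `v` of `A` and `w` of `T(A)` with `ρ(v) = T(π)(w)`. -/
noncomputable def app {Z : C} (v : Z ⟶ A.E) (w : Z ⟶ T.obj A.E)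
    (h : v ≫ A.ρ = w ≫ T.map A.proj) : Z ⟶ T.obj A.E :=
  pullback.lift v w h ≫ A.α

/-- `T(α)(w, z)` for generalised elements `w` of `T(A)` and `z` of `T²(A)` with
`T(ρ)(w) = T²(π)(z)`. -/
noncomputable def Tapp {Z : C} (w : Z ⟶ T.obj A.E) (z : Z ⟶ T.obj (T.obj A.E))
    (h : w ≫ T.map A.ρ = z ≫ T.map (T.map A.proj)) : Z ⟶ T.obj (T.obj A.E) :=
  A.prolT w z h ≫ T.map A.α

theorem app_p {Z : C} (v : Z ⟶ A.E) (w : Z ⟶ T.obj A.E) (h : v ≫ A.ρ = w ≫ T.map A.proj) :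
    A.app v w h ≫ p A.E = v := by
  rw [app, Category.assoc, A.α_p, pullback.lift_fst]

theorem app_Tproj {Z : C} (v : Z ⟶ A.E) (w : Z ⟶ T.obj A.E) (h : v ≫ A.ρ = w ≫ T.map A.proj) :
    A.app v w h ≫ T.map A.proj = w ≫ p A.E ≫ A.ρ := by
  rw [app, Category.assoc, A.α_Tproj, ← Category.assoc, pullback.lift_snd]

theorem app_Tρ {Z : C} (v : Z ⟶ A.E) (w : Z ⟶ T.obj A.E) (h : v ≫ A.ρ = w ≫ T.map A.proj) :
    A.app v w h ≫ T.map A.ρ = w ≫ T.map A.ρ ≫ c M := by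
  rw [app, Category.assoc, A.target, ← Category.assoc, pullback.lift_snd]

theorem Tapp_TTproj {Z : C} (w : Z ⟶ T.obj A.E) (z : Z ⟶ T.obj (T.obj A.E))
    (h : w ≫ T.map A.ρ = z ≫ T.map (T.map A.proj)) :
    A.Tapp w z h ≫ T.map (T.map A.proj) = z ≫ T.map (p A.E) ≫ T.map A.ρ := by
  rw [Tapp, AnchoredBundle.prolT, Category.assoc, ← T.map_comp, A.α_Tproj, T.map_comp, T.map_comp,
    IsPullback.lift_snd_assoc]

theorem unit_aux : (A.proj ≫ A.ξ) ≫ A.ρ = A.lift ≫ T.map A.proj := by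
  rw [Category.assoc, A.ξ_ρ, A.lift_Tproj]

theorem inv_aux : (pullback.snd A.ρ (T.map A.proj) ≫ p A.E) ≫ A.ρ = A.α ≫ T.map A.proj := by
  rw [A.α_Tproj, Category.assoc]

section Flip

variable {Z : C} (v : Z ⟶ A.E) (w : Z ⟶ T.obj A.E) (z : Z ⟶ T.obj (T.obj A.E))

theorem flip_aux₁ (h : v ≫ A.ρ = w ≫ T.map A.proj)
    (h' : z ≫ T.map (T.map A.proj) ≫ c M = w ≫ T.map A.ρ) :
    A.app v w h ≫ T.map A.ρ = z ≫ T.map (T.map A.proj) := by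
  rw [A.app_Tρ, ← Category.assoc, ← h', Category.assoc, Category.assoc, c_c, Category.comp_id]

theorem flip_aux₂ (h : v ≫ A.ρ = w ≫ T.map A.proj)
    (h' : z ≫ T.map (T.map A.proj) ≫ c M = w ≫ T.map A.ρ) :
    v ≫ A.ρ = (z ≫ p (T.obj A.E)) ≫ T.map A.proj := by
  have := congrArg (· ≫ T.map (p M)) h'
  simp only [Category.assoc, c_Tp, ← T.map_comp, A.ρ_p] at this
  rw [h, Category.assoc, ← p_naturality, this]

theorem flip_aux₃ (h' : z ≫ T.map (T.map A.proj) ≫ c M = w ≫ T.map A.ρ) :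
    w ≫ T.map A.ρ = (z ≫ c A.E) ≫ T.map (T.map A.proj) := by
  rw [← h', Category.assoc, c_naturality]

theorem flip_aux₄ (h : v ≫ A.ρ = w ≫ T.map A.proj)
    (h' : z ≫ T.map (T.map A.proj) ≫ c M = w ≫ T.map A.ρ) :
    A.app v (z ≫ p (T.obj A.E)) (A.flip_aux₂ v w z h h') ≫ T.map A.ρ =
      (A.Tapp w (z ≫ c A.E) (A.flip_aux₃ w z h') ≫ c A.E) ≫ T.map (T.map A.proj) := by
  rw [A.app_Tρ, Category.assoc (A.Tapp _ _ _), ← c_naturality, ← Category.assoc (A.Tapp _ _ _),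
    A.Tapp_TTproj]
  simp only [Category.assoc]
  rw [← Category.assoc (c A.E), c_Tp]

end Flip

end PreInvolutionAlgebroid

/-- An involution algebroid over `M`. -/
structure InvolutionAlgebroid (M : C) extends PreInvolutionAlgebroid M where
  /-- `α(ξπ, λ) = λ` -/
  unit : toPreInvolutionAlgebroid.app (proj ≫ bundle.zero) lift
    toPreInvolutionAlgebroid.unit_aux = lift
  /-- `α(pπ₁, α) = π₁` -/
  inv : toPreInvolutionAlgebroid.app (pullback.snd _ _ ≫ p E) α
    toPreInvolutionAlgebroid.inv_aux = pullback.snd _ _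
  /-- `T(α)(α(v, w), z) = c T(α)(α(v, p z), c T(α)(w, c z))` for all `v` in `A`, `w` in `T(A)` and
  `z` in `T²(A)` with `ρ v = T(π) w` and `c T²(π) z = T(ρ) w` -/
  flip : ∀ {Z : C} (v : Z ⟶ E) (w : Z ⟶ T.obj E) (z : Z ⟶ T.obj (T.obj E))
    (h : v ≫ ρ = w ≫ T.map proj) (h' : z ≫ T.map (T.map proj) ≫ c M = w ≫ T.map ρ),
    toPreInvolutionAlgebroid.Tapp (toPreInvolutionAlgebroid.app v w h) z
        (toPreInvolutionAlgebroid.flip_aux₁ v w z h h') =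
      toPreInvolutionAlgebroid.Tapp
        (toPreInvolutionAlgebroid.app v (z ≫ p (T.obj E))
          (toPreInvolutionAlgebroid.flip_aux₂ v w z h h'))
        (toPreInvolutionAlgebroid.Tapp w (z ≫ c E)
          (toPreInvolutionAlgebroid.flip_aux₃ w z h') ≫ c E)
        (toPreInvolutionAlgebroid.flip_aux₄ v w z h h') ≫ c E

namespace InvolutionAlgebroid

variable (A : InvolutionAlgebroid M)

/-- The sections of the underlying bundle `π : A ⟶ M`. -/
abbrev Section := Sec A.toDifferentialBundle

variable {A}

/-- `T(Y) ρ X : M ⟶ T(A)`. -/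
noncomputable def deriv (X Y : A.Section) : M ⟶ T.obj A.E := X.map ≫ A.ρ ≫ T.map Y.map

theorem deriv_p (X Y : A.Section) : deriv X Y ≫ p A.E = Y.map := by
  rw [deriv, Category.assoc, Category.assoc, p_naturality, ← Category.assoc A.ρ, A.ρ_p,
    ← Category.assoc, X.w, Category.id_comp]

theorem deriv_Tproj (X Y : A.Section) : X.map ≫ A.ρ = deriv X Y ≫ T.map A.proj := by
  rw [deriv, Category.assoc, Category.assoc, ← T.map_comp, Y.w, T.map_id, Category.comp_id]

/-- `α(X, T(Y) ρ X) : M ⟶ T(A)`. -/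
noncomputable def transfer (X Y : A.Section) : M ⟶ T.obj A.E :=
  A.app X.map (deriv X Y) (deriv_Tproj X Y)

theorem transfer_p (X Y : A.Section) : transfer X Y ≫ p A.E = X.map := A.app_p _ _ _

theorem transfer_Tproj (X Y : A.Section) : transfer X Y ≫ T.map A.proj = Y.map ≫ A.ρ := by
  rw [transfer, A.app_Tproj, ← Category.assoc, deriv_p]

/-- The bracket of two sections of an involution algebroid: the strong difference of
`α(X, T(Y) ρ X)` and `T(X) ρ Y`. -/
noncomputable def bracket (X Y : A.Section) : A.Section where
  map := A.strongDiff (transfer X Y) (deriv Y X) (by rw [transfer_p, deriv_p])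
    (by rw [transfer_Tproj, deriv_Tproj])
  w := by rw [A.strongDiff_proj, ← Category.assoc, deriv_p, X.w]

/-- The defining equation of the bracket:
`λ [X, Y] = (α(X, T(Y) ρ X) -_p T(X) ρ Y) -_{T(π)} 0 X`. -/
theorem bracket_lift (X Y : A.Section) : (bracket X Y).map ≫ A.lift =
    A.rawDiff (transfer X Y) (deriv Y X) (by rw [transfer_p, deriv_p])
      (by rw [transfer_Tproj, deriv_Tproj]) :=
  A.strongDiff_lift _ _ _ _

end InvolutionAlgebroid

theorem trivial_isPullback (A : DifferentialBundle M) :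
    IsPullback A.proj (𝟙 A.E) (trivialBundle M).proj A.proj := by
  change IsPullback A.proj (𝟙 A.E) (𝟙 M) A.proj
  exact IsPullback.of_id_snd

/-! Unit objects -/

section Unit

variable [HasFiniteProducts C] [PreservesFiniteProducts (T : C ⥤ C)]

/-- The generalised element `(x, y)` of `T(X × Y) ≅ T(X) × T(Y)`. -/
noncomputable def prodT {X Y Z : C} (x : Z ⟶ T.obj X) (y : Z ⟶ T.obj Y) : Z ⟶ T.obj (X ⨯ Y) :=
  prod.lift x y ≫ (PreservesLimitPair.iso (T : C ⥤ C) X Y).inv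

theorem prodT_p {X Y Z : C} (x : Z ⟶ T.obj X) (y : Z ⟶ T.obj Y) :
    prodT x y ≫ p (X ⨯ Y) = prod.lift (x ≫ p X) (y ≫ p Y) := by
  apply Limits.prod.hom_ext
  · rw [prodT, Category.assoc, Category.assoc, ← p_naturality,
      PreservesLimitPair.iso_inv_fst_assoc, prod.lift_fst, prod.lift_fst_assoc]
  · rw [prodT, Category.assoc, Category.assoc, ← p_naturality,
      PreservesLimitPair.iso_inv_snd_assoc, prod.lift_snd, prod.lift_snd_assoc]

/-- A differential object: a differential bundle over the terminal object. -/
abbrev DifferentialObject (C : Type u) [Category.{v} C] [TangentCategory C]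
    [HasFiniteProducts C] := DifferentialBundle (⊤_ C)

/-- The map `p̂ : T(E) ⟶ E` of a differential object: `p̂(μ(a, b)) = b`. -/
noncomputable def phat (R : DifferentialObject C) : T.obj R.E ⟶ R.E :=
  R.verticalPart (𝟙 _) ((terminalIsTerminal.isTerminalObj (T : C ⥤ C)).hom_ext _ _)

/-- The element `(0, λ)` of `T(V ×_M W)`, i.e. the lift in the second variable. -/
noncomputable def sndLift [HasSubstitution C] {V W : DifferentialBundle M} {P : C} {a : P ⟶ V.E}
    {b : P ⟶ W.E} (hP : IsPullback a b V.proj W.proj) : P ⟶ T.obj P :=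
  (hP.map T).lift (a ≫ PreTangentCategory.zero V.E) (b ≫ W.lift) (by
    rw [Category.assoc, Category.assoc, ← zero_naturality, W.lift_Tproj, ← Category.assoc,
      ← Category.assoc, hP.w])

/-- `g : R × P ⟶ E` is, over `M`, an extension of `f : P ⟶ E` along the point `u` that is linear in
the variable `R`. Here `R × P` is the fibre product over `M` of the trivial bundle `R × M ⟶ M` with
`P`, and its lift in the first variable is `λ_R × 0`. -/
structure IsScalarExtension (R : DifferentialObject C) (u : ⊤_ C ⟶ R.E) (E : DifferentialBundle M)
    {P : C} (f : P ⟶ E.E) (g : R.E ⨯ P ⟶ E.E) : Prop where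
  proj : g ≫ E.proj = prod.snd ≫ f ≫ E.proj
  unit : prod.lift (terminal.from P ≫ u) (𝟙 P) ≫ g = f
  linear : g ≫ E.lift =
    prodT (prod.fst ≫ R.lift) (prod.snd ≫ PreTangentCategory.zero P) ≫ T.map g

/-- The trivial bundle `R × M ⟶ M` with the point `(u, id)` is a unit among the differential bundles
over `M` (the differential objects of the slice over `M`): every map `f : V ×_M W ⟶ E` over `M`
extends uniquely to a map `R × (V ×_M W) ⟶ E` over `M` that is linear in `R`; if `f` is linear in
`W`, then so is the extension. The fibre product `V ×_M W` is given by an arbitrary pullback `P`. -/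
def IsUnitOver [HasSubstitution C] (R : DifferentialObject C) (u : ⊤_ C ⟶ R.E) (M : C) : Prop :=
  ∀ (V W E : DifferentialBundle M) {P : C} (a : P ⟶ V.E) (b : P ⟶ W.E)
    (hP : IsPullback a b V.proj W.proj) (f : P ⟶ E.E), f ≫ E.proj = a ≫ V.proj →
    (∃! g : R.E ⨯ P ⟶ E.E, IsScalarExtension R u E f g) ∧
    ∀ g : R.E ⨯ P ⟶ E.E, IsScalarExtension R u E f g →
      f ≫ E.lift = sndLift hP ≫ T.map f →
      g ≫ E.lift =
        prodT (prod.fst ≫ PreTangentCategory.zero R.E) (prod.snd ≫ sndLift hP) ≫ T.map g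

variable [HasSubstitution C]

/-- A differential object with a point that is a unit in every slice. -/
structure PreUnitObject (C : Type u) [Category.{v} C] [TangentCategory C] [HasFiniteProducts C]
    [PreservesFiniteProducts (T : C ⥤ C)] [HasSubstitution C] where
  R : DifferentialObject C
  u : ⊤_ C ⟶ R.E
  isUnit : ∀ M : C, IsUnitOver R u M

namespace PreUnitObject

variable (U : PreUnitObject C)

theorem existsUnique_smul (A : DifferentialBundle M) :
    ∃! g : U.R.E ⨯ A.E ⟶ A.E, IsScalarExtension U.R U.u A (𝟙 A.E) g :=
  (U.isUnit M (trivialBundle M) A A A.proj (𝟙 A.E) (trivial_isPullback A)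
    (𝟙 A.E) (Category.id_comp _ |>.trans (Category.comp_id _).symm)).1

/-- Scalar multiplication `• : R × A ⟶ A` in the fibres of `A`: the unique extension of the
identity of `A`. -/
noncomputable def smul (A : DifferentialBundle M) : U.R.E ⨯ A.E ⟶ A.E :=
  (U.existsUnique_smul A).choose

theorem smul_spec (A : DifferentialBundle M) :
    IsScalarExtension U.R U.u A (𝟙 A.E) (U.smul A) :=
  (U.existsUnique_smul A).choose_spec.1

/-- `r • a` for generalised elements `r` of `R` and `a` of `A`. -/
noncomputable def act (A : DifferentialBundle M) {Z : C} (r : Z ⟶ U.R.E) (a : Z ⟶ A.E) : Z ⟶ A.E :=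
  prod.lift r a ≫ U.smul A

theorem act_proj (A : DifferentialBundle M) {Z : C} (r : Z ⟶ U.R.E) (a : Z ⟶ A.E) :
    U.act A r a ≫ A.proj = a ≫ A.proj := by
  rw [act, Category.assoc, (U.smul_spec A).proj, Category.id_comp, prod.lift_snd_assoc]

theorem torsion_aux (A : DifferentialBundle M) {Z : C} (r : Z ⟶ U.R.E) (w : Z ⟶ T.obj A.E) :
    (U.act A r (w ≫ p A.E) ≫ A.lift) ≫ p A.E = (w ≫ T.map (A.proj ≫ A.ξ)) ≫ p A.E := by
  rw [Category.assoc, A.lift_p, ← Category.assoc, U.act_proj]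
  simp only [Category.assoc, p_naturality]

end PreUnitObject

/-- A (fibred) unit object. -/
structure UnitObject (C : Type u) [Category.{v} C] [TangentCategory C] [HasFiniteProducts C]
    [PreservesFiniteProducts (T : C ⥤ C)] [HasSubstitution C] extends PreUnitObject C where
  /-- Scalar multiplication is preserved by substitution: `B` is the pullback of `A` along `f`. -/
  substitution : ∀ {M N : C} (A : DifferentialBundle M) (B : DifferentialBundle N) (f : N ⟶ M)
    (h : B.E ⟶ A.E), IsPullback h B.proj A.proj f → IsLinearHom B A h f →
    toPreUnitObject.smul B ≫ h = prod.map (𝟙 R.E) h ≫ toPreUnitObject.smul A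
  /-- Scalar multiplication is torsion free: `λ_R(r) •ᵀ w = λ(r • p(w)) +_p T(ξπ)(w)`. (Note that
  `λ(r • v)` is the product of `r` and `λ(v)` in the bundle `T(π)`.) -/
  torsion_free : ∀ {M : C} (A : DifferentialBundle M) {Z : C} (r : Z ⟶ R.E) (w : Z ⟶ T.obj A.E),
    prodT (r ≫ R.lift) w ≫ T.map (toPreUnitObject.smul A) =
      (tOps A.E).plus (toPreUnitObject.act A r (w ≫ p A.E) ≫ A.lift) (w ≫ T.map (A.proj ≫ A.ξ))
        (toPreUnitObject.torsion_aux A r w)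

namespace UnitObject

variable (U : UnitObject C)

/-- The section `ψ • Y`, for `ψ : M ⟶ R` and a section `Y` of `A`. -/
noncomputable def smulSec {A : DifferentialBundle M} (ψ : M ⟶ U.R.E) (Y : Sec A) : Sec A :=
  ⟨U.act A ψ Y.map, by rw [U.act_proj, Y.w]⟩

/-- The derivative `L_{ρX}(ψ) = p̂ T(ψ) ρ X` of `ψ : M ⟶ R`. -/
noncomputable def lieDeriv {A : InvolutionAlgebroid M} (X : A.Section) (ψ : M ⟶ U.R.E) :
    M ⟶ U.R.E :=
  X.map ≫ A.ρ ≫ T.map ψ ≫ phat U.R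

end UnitObject

end Unit

end Bundles

end TangentCat

/-!
Write `a = α(X, T(Y) ρ X)` and `L = L_{ρX}(ψ)`. The Leibniz law is an expansion of
`α(X, T(ψ • Y) ρ X)` in which every step is the additivity or the homogeneity of a linear map.

Since `T(ψ) ρ X = 0ψ +_T λ_R(L)` and `•` is additive in the scalar, torsion freeness gives
`T(ψ • Y) ρ X = T(•)(0ψ, T(Y) ρ X) +_{T(π)} (λ(L • Y) +_p T(ξ) ρ X)` (`deriv_smulSec`). The map `α` is
additive and homogeneous from `π₀` to `p`, and additive from `pπ₁` to `T(π)`; with `α(ξ, λ) = λ` and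
`α(X, T(ξ) ρ X) = 0X` this yields `α(X, T(ψ • Y) ρ X) = ψ •_p a +_p (λ(L • Y) +_{T(π)} 0X)`
(`transfer_smulSec`). Both assertions follow by the interchange law for `+_p` and `+_{T(π)}`
(`interchange`) and from `ψ •_p (λd +_{T(π)} 0X) = λ(ψ • d) +_{T(π)} 0X` (`act_zero_plus_lift`).

*Linear maps are additive* because a lift turns the addition of a bundle into the addition `+_p`,
which is natural, and because the lift of the target is monic. For `T(π)`, whose lift is `c T(λ)`, this
requires `T(λ)` to be monic (`DifferentialBundle.Tlift_cancel`), although `T` need not preserve the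
equalizer that makes `λ` universal: `λ` factors through the pullback of `p` along the zero section,
which `T` preserves, by a split monomorphism.

*Linear maps are homogeneous* because a map `R × Z ⟶ A` over `M` that is linear in the scalar is
determined by its value at the unit point, for an arbitrary object `Z`
(`PreUnitObject.scalarExtension_unique`). The unit property speaks of fibre products of differential
bundles over a common base only; it is applied over the base `Z`, to the trivial bundles and to the
pullback of `A` along `Z ⟶ M`. That this pullback is a differential bundle involves `T²` of a
pullback. For tangent bundles the latter is under control, since `c` identifies `T(p)` with `p`
(`TTpullback_hom_ext`), and composition with the monic linear map `λ : A ⟶ T(A)` reduces the general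
case to that one.
-/

namespace TangentCat

/-! ### Additive bundles and their images under a functor -/

section Additive

variable {C : Type u} [Category.{v} C] {E M : C} {q : E ⟶ M} [HasPullback q q]

namespace FibreOps

theorem plus_fst_snd (S : FibreOps q) :
    S.plus (pullback.fst q q) (pullback.snd q q) pullback.condition = S.add := by
  have e : pullback.lift (pullback.fst q q) (pullback.snd q q) pullback.condition = 𝟙 _ := by
    apply pullback.hom_ext <;> simp
  rw [plus, e, Category.id_comp]

theorem comp_minus (S : FibreOps q) {Z W : C} (g : W ⟶ Z) (a b : Z ⟶ E) (h : a ≫ q = b ≫ q) :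
    g ≫ S.minus a b h = S.minus (g ≫ a) (g ≫ b) (by simp [h]) := by
  unfold minus
  rw [comp_plus]
  exact S.plus_congr rfl (Category.assoc _ _ _).symm _

theorem minus_congr (S : FibreOps q) {Z : C} {a b a' b' : Z ⟶ E} (ha : a = a') (hb : b = b')
    (h : a ≫ q = b ≫ q) : S.minus a b h = S.minus a' b' (by rw [← ha, ← hb, h]) := by
  subst ha hb; rfl

section Map

variable (S : FibreOps q) (F : C ⥤ C) [PreservesLimit (cospan q q) F]

/-- Generalised elements of `F(E)` in the same fibre over `F(M)` come from one generalised element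
of `F(E ×_M E)`; an identity between expressions in two variables therefore passes from `S` to its
image under `F`. -/
theorem exists_pair {Z : C} (a b : Z ⟶ F.obj E) (h : a ≫ F.map q = b ≫ F.map q) :
    ∃ t : Z ⟶ F.obj (pullback q q), t ≫ F.map (pullback.fst q q) = a ∧
      t ≫ F.map (pullback.snd q q) = b :=
  ⟨((IsPullback.of_hasPullback q q).map F).lift a b h, by simp, by simp⟩

theorem map_plus_comp {W Z : C} (t : Z ⟶ F.obj W) (x y : W ⟶ E) (h : x ≫ q = y ≫ q) :
    (S.map F).plus (t ≫ F.map x) (t ≫ F.map y)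
      (by simp only [Category.assoc, ← F.map_comp, h]) = t ≫ F.map (S.plus x y h) := by
  rw [FibreOps.map_plus]
  refine Eq.trans ?_ (congrArg (t ≫ ·) (F.map_comp _ _).symm)
  refine Eq.trans (congrArg (· ≫ F.map S.add) ?_) (Category.assoc _ _ _)
  apply ((IsPullback.of_hasPullback q q).map F).hom_ext
  · rw [IsPullback.lift_fst, Category.assoc, ← F.map_comp, pullback.lift_fst]
  · rw [IsPullback.lift_snd, Category.assoc, ← F.map_comp, pullback.lift_snd]

theorem map_minus_comp {W Z : C} (t : Z ⟶ F.obj W) (x y : W ⟶ E) (h : x ≫ q = y ≫ q) :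
    (S.map F).minus (t ≫ F.map x) (t ≫ F.map y)
      (by simp only [Category.assoc, ← F.map_comp, h]) = t ≫ F.map (S.minus x y h) := by
  unfold minus
  rw [← map_plus_comp]
  refine plus_congr _ rfl ?_ _
  rw [F.map_comp, Category.assoc]
  rfl

end Map

end FibreOps

namespace AdditiveBundle

variable (S : AdditiveBundle q) {Z : C}

theorem plus_zero (a : Z ⟶ E) :
    S.plus a (a ≫ q ≫ S.zero) (by simp [S.zero_proj]) = a := by
  rw [S.plus_comm, S.zero_plus]

theorem minus_plus_cancel (a b : Z ⟶ E) (h : a ≫ q = b ≫ q) :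
    S.plus (S.minus a b h) b (by rw [FibreOps.minus_proj, h]) = a := by
  unfold FibreOps.minus
  rw [S.plus_assoc]
  · rw [S.toFibreOps.plus_congr rfl (S.neg_plus b)]
    refine (S.toFibreOps.plus_congr rfl ?_ _).trans (S.plus_zero a)
    rw [← Category.assoc, ← h, Category.assoc]
  · rw [Category.assoc, S.neg_proj]

theorem plus_minus_cancel (a b : Z ⟶ E) (h : a ≫ q = b ≫ q) :
    S.minus (S.plus a b h) b (by rw [FibreOps.plus_proj, h]) = a := by
  unfold FibreOps.minus
  rw [S.plus_assoc]
  · refine (S.toFibreOps.plus_congr rfl (S.minus_self b) _).trans ?_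
    refine (S.toFibreOps.plus_congr rfl ?_ _).trans (S.plus_zero a)
    rw [← Category.assoc, ← h, Category.assoc]

theorem eq_minus_of_plus_eq {a b d : Z ⟶ E} (h : a ≫ q = b ≫ q) (e : S.plus a b h = d) :
    a = S.minus d b (by rw [← e, FibreOps.plus_proj, h]) := by
  subst e
  exact (S.plus_minus_cancel a b h).symm

theorem minus_zero {a z : Z ⟶ E} (h : a ≫ q = z ≫ q) (hz : z = a ≫ q ≫ S.zero) :
    S.minus a z h = a := by
  subst hz
  exact (S.eq_minus_of_plus_eq _ (S.plus_zero a)).symm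

theorem plus_minus_right_comm (a b d : Z ⟶ E) (h : a ≫ q = b ≫ q) (h' : a ≫ q = d ≫ q) :
    S.minus (S.plus a b h) d (by rw [FibreOps.plus_proj, h']) =
      S.plus (S.minus a d h') b (by rw [FibreOps.minus_proj, h]) := by
  unfold FibreOps.minus
  have hd : (d ≫ S.neg) ≫ q = d ≫ q := by rw [Category.assoc, S.neg_proj]
  rw [S.plus_assoc _ _ _ h (by rw [hd, ← h, h']),
    S.plus_assoc _ _ _ (by rw [hd, h']) (by rw [hd, ← h, h'])]
  exact S.toFibreOps.plus_congr rfl (S.plus_comm _ _ _) _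

section Map

variable (F : C ⥤ C) [PreservesLimit (cospan q q) F]

theorem map_plus_zero (a : Z ⟶ F.obj E) :
    (S.map F).plus a (a ≫ F.map (q ≫ S.zero))
      (by simp only [Category.assoc, ← F.map_comp, S.zero_proj, Category.comp_id]) = a := by
  have h := S.map_plus_comp F a (𝟙 E) (q ≫ S.zero) (by simp [S.zero_proj])
  have e := S.plus_zero (𝟙 E)
  simp only [Category.id_comp] at e
  rw [e] at h
  simpa using h

theorem map_plus_comm (a b : Z ⟶ F.obj E) (h : a ≫ F.map q = b ≫ F.map q) :
    (S.map F).plus a b h = (S.map F).plus b a h.symm := by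
  obtain ⟨t, rfl, rfl⟩ := FibreOps.exists_pair F a b h
  rw [S.map_plus_comp F t _ _ pullback.condition, S.map_plus_comp F t _ _ pullback.condition.symm,
    S.plus_comm]

theorem map_minus_plus_cancel (a b : Z ⟶ F.obj E) (h : a ≫ F.map q = b ≫ F.map q) :
    (S.map F).plus ((S.map F).minus a b h) b (by rw [FibreOps.minus_proj, h]) = a := by
  obtain ⟨t, rfl, rfl⟩ := FibreOps.exists_pair F a b h
  rw [FibreOps.plus_congr _ (S.map_minus_comp F t _ _ pullback.condition) rfl,
    S.map_plus_comp F t _ _ (by rw [FibreOps.minus_proj, pullback.condition]),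
    S.minus_plus_cancel]

theorem map_plus_minus_cancel (a b : Z ⟶ F.obj E) (h : a ≫ F.map q = b ≫ F.map q) :
    (S.map F).minus ((S.map F).plus a b h) b (by rw [FibreOps.plus_proj, h]) = a := by
  obtain ⟨t, rfl, rfl⟩ := FibreOps.exists_pair F a b h
  rw [FibreOps.minus_congr _ (S.map_plus_comp F t _ _ pullback.condition) rfl,
    S.map_minus_comp F t _ _ (by rw [FibreOps.plus_proj, pullback.condition]),
    S.plus_minus_cancel]

end Map

end AdditiveBundle

namespace IsAdditiveHom

variable {E' M' : C} {q' : E' ⟶ M'} [HasPullback q' q'] {S : FibreOps q} {S' : FibreOps q'}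
  {φ : E ⟶ E'} {f : M ⟶ M'}

theorem of_plus (w : φ ≫ q' = q ≫ f) (map_zero : S.zero ≫ φ = f ≫ S'.zero)
    (map_plus : ∀ {Z : C} (a b : Z ⟶ E) (h : a ≫ q = b ≫ q), S.plus a b h ≫ φ =
      S'.plus (a ≫ φ) (b ≫ φ) (by simp only [Category.assoc, w]; rw [← Category.assoc, h,
        Category.assoc])) : IsAdditiveHom S S' φ f where
  w := w
  map_zero := map_zero
  map_add := by
    rw [← S.plus_fst_snd, map_plus, FibreOps.plus]

theorem map (H : IsAdditiveHom S S' φ f) (F : C ⥤ C) [PreservesLimit (cospan q q) F]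
    [PreservesLimit (cospan q' q') F] :
    IsAdditiveHom (S.map F) (S'.map F) (F.map φ) (F.map f) := by
  refine of_plus (by rw [← F.map_comp, H.w, F.map_comp]) ?_ ?_
  · change F.map S.zero ≫ F.map φ = F.map f ≫ F.map S'.zero
    rw [← F.map_comp, H.map_zero, F.map_comp]
  · intro Z a b h
    obtain ⟨t, rfl, rfl⟩ := FibreOps.exists_pair F a b h
    rw [S.map_plus_comp F t _ _ pullback.condition, Category.assoc, ← F.map_comp, H.plus,
      ← S'.map_plus_comp F]
    exact S'.map F |>.plus_congr (by simp) (by simp) _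

end IsAdditiveHom

end Additive

section PreTangent

open PreTangentCategory

variable {C : Type u} [Category.{v} C] [PreTangentCategory C]

theorem plus_Tmap {E F : C} (f : E ⟶ F) {Z : C} (a b : Z ⟶ T.obj E) (h : a ≫ p E = b ≫ p E) :
    (tOps E).plus a b h ≫ T.map f = (tOps F).plus (a ≫ T.map f) (b ≫ T.map f)
      (by simp only [Category.assoc, p_naturality]; rw [← Category.assoc, h, Category.assoc]) :=
  (bundle_naturality f).plus a b h

theorem zero_plus_zero {E : C} {Z : C} (a : Z ⟶ E) :
    (tOps E).plus (a ≫ PreTangentCategory.zero E) (a ≫ PreTangentCategory.zero E) rfl =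
      a ≫ PreTangentCategory.zero E := by
  have h := (bundle E).plus_zero (a ≫ PreTangentCategory.zero E)
  refine ((tOps E).plus_congr rfl ?_ _).trans h
  rw [Category.assoc, ← Category.assoc (PreTangentCategory.zero E), zero_p, Category.id_comp,
    bundle_zero]

theorem tOps_zero (E : C) : (tOps E).zero = PreTangentCategory.zero E := bundle_zero E

/-- The interchange law between the addition of `T(E) ⟶ E` and the image under `T` of the addition
of a bundle `E ⟶ M`; it is the naturality of the former with respect to the latter. -/
theorem interchange {E M : C} {q : E ⟶ M} [HasPullback q q] (S : FibreOps q)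
    [PreservesLimit (cospan q q) (T : C ⥤ C)] {Z : C} (a b a' b' : Z ⟶ T.obj E)
    (h : a ≫ T.map q = b ≫ T.map q) (h' : a' ≫ T.map q = b' ≫ T.map q)
    (k : a ≫ p E = a' ≫ p E) (k' : b ≫ p E = b' ≫ p E) :
    (tOps E).plus ((S.map T).plus a b h) ((S.map T).plus a' b' h')
        (by rw [map_plus_p, map_plus_p]; exact S.plus_congr k k' _) =
      (S.map T).plus ((tOps E).plus a a' k) ((tOps E).plus b b' k')
        (by rw [plus_Tmap, plus_Tmap]; exact (tOps M).plus_congr h h' _) := by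
  obtain ⟨t, rfl, rfl⟩ := FibreOps.exists_pair T a b h
  obtain ⟨t', rfl, rfl⟩ := FibreOps.exists_pair T a' b' h'
  have ht : t ≫ p _ = t' ≫ p _ := by
    apply pullback.hom_ext
    · simpa only [Category.assoc, p_naturality] using k
    · simpa only [Category.assoc, p_naturality] using k'
  rw [FibreOps.plus_congr (S.map T) (plus_Tmap _ _ _ ht).symm (plus_Tmap _ _ _ ht).symm,
    S.map_plus_comp T ((tOps _).plus t t' ht) _ _ pullback.condition, plus_Tmap]
  exact FibreOps.plus_congr _ (S.map_plus_comp T t _ _ pullback.condition)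
    (S.map_plus_comp T t' _ _ pullback.condition) _

end PreTangent

/-! ### Differential bundles -/

section Bundles

open PreTangentCategory

variable {C : Type u} [Category.{v} C] [TangentCategory C] {M : C}

namespace DifferentialBundle

variable (A : DifferentialBundle M)

theorem mu_hom_ext {Z : C} {x y : Z ⟶ pullback A.proj A.proj} (h : x ≫ A.mu = y ≫ A.mu) :
    x = y :=
  Fork.IsLimit.hom_ext A.universal.some h

theorem mu_eq : A.mu = A.Tops.plus (pullback.fst _ _ ≫ PreTangentCategory.zero A.E)
    (pullback.snd _ _ ≫ A.lift) (by
      rw [Category.assoc, Category.assoc, ← zero_naturality, A.lift_Tproj, ← Category.assoc,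
        ← Category.assoc, pullback.condition]) := rfl

/-- `λ = μ(ξπ, id)`. -/
theorem lift_eq_mu : pullback.lift (A.proj ≫ A.ξ) (𝟙 A.E)
    (by rw [Category.assoc, A.ξ_proj, Category.comp_id, Category.id_comp]) ≫ A.mu = A.lift := by
  have h := A.bundle.map_plus_zero T A.lift
  rw [A.bundle.map_plus_comm T] at h
  rw [mu_eq, FibreOps.comp_plus]
  refine (FibreOps.plus_congr _ ?_ ?_ _).trans h
  · rw [pullback.lift_fst_assoc, Category.assoc, zero_naturality, T.map_comp,
      ← Category.assoc A.lift, A.lift_Tproj, Category.assoc]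
  · rw [pullback.lift_snd_assoc, Category.id_comp]

/-- The lift is monic. -/
theorem lift_cancel {Z : C} {x y : Z ⟶ A.E} (h : x ≫ A.lift = y ≫ A.lift) : x = y := by
  have h' := A.mu_hom_ext (Z := Z) (x := x ≫ pullback.lift (A.proj ≫ A.ξ) (𝟙 A.E) (by simp [A.ξ_proj]))
    (y := y ≫ pullback.lift (A.proj ≫ A.ξ) (𝟙 A.E) (by simp [A.ξ_proj]))
    (by simpa only [Category.assoc, lift_eq_mu] using h)
  simpa only [Category.assoc, pullback.lift_snd, Category.comp_id] using
    congrArg (· ≫ pullback.snd A.proj A.proj) h'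

theorem comp_rawDiff {Z W : C} (g : W ⟶ Z) (a b : Z ⟶ T.obj A.E) (hp : a ≫ p A.E = b ≫ p A.E)
    (hT : a ≫ T.map A.proj = b ≫ T.map A.proj) :
    g ≫ A.rawDiff a b hp hT = A.rawDiff (g ≫ a) (g ≫ b) (by simp [hp]) (by simp [hT]) := by
  unfold rawDiff
  rw [FibreOps.comp_minus]
  exact FibreOps.minus_congr _ (FibreOps.comp_minus _ _ _ _ _) (Category.assoc _ _ _).symm _

theorem lift_T_proj_ξ :
    A.lift ≫ T.map (A.proj ≫ A.ξ) = A.proj ≫ A.ξ ≫ PreTangentCategory.zero A.E := by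
  rw [T.map_comp, ← Category.assoc, A.lift_Tproj, Category.assoc, zero_naturality]

/-- The lift is the difference of itself and the zero vector at the same point. -/
theorem rawDiff_lift (hp hT) :
    A.rawDiff A.lift (A.lift ≫ T.map (A.proj ≫ A.ξ)) hp hT = A.lift := by
  have hz : (A.lift ≫ T.map (A.proj ≫ A.ξ)) ≫ p A.E ≫ PreTangentCategory.zero A.E =
      A.lift ≫ T.map (A.proj ≫ A.ξ) := by
    rw [lift_T_proj_ξ]
    simp only [Category.assoc]
    rw [← Category.assoc (PreTangentCategory.zero A.E), zero_p, Category.id_comp]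
  have h1 : (tOps A.E).minus A.lift (A.lift ≫ T.map (A.proj ≫ A.ξ)) hp = A.lift := by
    apply (bundle A.E).minus_zero
    rw [bundle_zero, lift_T_proj_ξ, ← Category.assoc A.lift, A.lift_p, Category.assoc]
  have h2 := A.bundle.map_plus_minus_cancel T A.lift (A.lift ≫ T.map (A.proj ≫ A.ξ)) hT
  unfold rawDiff
  refine (FibreOps.minus_congr _ ?_ hz _).trans h2
  exact h1.trans (A.bundle.map_plus_zero T A.lift).symm

section Substitution

variable [HasSubstitution C]

/-- `T(λ)` is monic: `λ` is the composite of a split monomorphism into the pullback of `p` along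
the zero section, whose retraction is `w ↦ λ⁻¹(w - T(ξπ)(w))`, and a projection of that pullback,
which `T` preserves. -/
theorem Tlift_cancel {Z : C} {x y : Z ⟶ T.obj A.E} (h : x ≫ T.map A.lift = y ≫ T.map A.lift) :
    x = y := by
  have : HasPullback (p A.E) A.ξ := HasSubstitution.hasPullback (tangentBundle A.E) A.ξ
  have : PreservesLimit (cospan (p A.E) A.ξ) (T : C ⥤ C) :=
    HasSubstitution.preserves (tangentBundle A.E) A.ξ
  have hp : pullback.fst (p A.E) A.ξ ≫ p A.E =
      (pullback.fst (p A.E) A.ξ ≫ T.map (A.proj ≫ A.ξ)) ≫ p A.E := by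
    rw [Category.assoc, p_naturality, ← Category.assoc _ (p A.E), pullback.condition]
    simp only [Category.assoc]
    rw [← Category.assoc A.ξ A.proj, A.ξ_proj, Category.id_comp]
  have hT : pullback.fst (p A.E) A.ξ ≫ T.map A.proj =
      (pullback.fst (p A.E) A.ξ ≫ T.map (A.proj ≫ A.ξ)) ≫ T.map A.proj := by
    rw [Category.assoc, ← T.map_comp, Category.assoc, A.ξ_proj, Category.comp_id]
  -- `i` is `λ` with values in the pullback, `k` its retraction `w ↦ λ⁻¹(w - T(ξπ)(w))`
  let i : A.E ⟶ pullback (p A.E) A.ξ := pullback.lift A.lift A.proj A.lift_p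
  let k : pullback (p A.E) A.ξ ⟶ A.E := A.strongDiff _ _ hp hT
  have hik : i ≫ k = 𝟙 A.E := by
    apply A.lift_cancel
    rw [Category.assoc, A.strongDiff_lift, comp_rawDiff, Category.id_comp]
    have h1 : i ≫ pullback.fst _ _ = A.lift := pullback.lift_fst _ _ _
    have h2 : i ≫ pullback.fst _ _ ≫ T.map (A.proj ≫ A.ξ) = A.lift ≫ T.map (A.proj ≫ A.ξ) := by
      rw [← Category.assoc, h1]
    simp only [h1, h2]
    exact A.rawDiff_lift _ _
  have hi : x ≫ T.map i = y ≫ T.map i := by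
    apply ((IsPullback.of_hasPullback (p A.E) A.ξ).map T).hom_ext
    · simpa only [Category.assoc, ← T.map_comp, i, pullback.lift_fst] using h
    · simp only [Category.assoc, ← T.map_comp, i, pullback.lift_snd]
      have h3 := congrArg (· ≫ T.map (p A.E ≫ A.proj)) h
      simp only [Category.assoc, ← T.map_comp] at h3
      rwa [← Category.assoc A.lift, A.lift_p, Category.assoc, A.ξ_proj, Category.comp_id] at h3
  have := congrArg (· ≫ T.map k) hi
  simpa only [Category.assoc, ← T.map_comp, hik, T.map_id, Category.comp_id] using this

end Substitution

/-! ### Pulling back differential bundles -/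

section Pullback

variable [HasSubstitution C] {N : C} (f : N ⟶ M)

/-- `f^*A ×_N f^*A` is the pullback of `A` along `f^*A ⟶ N ⟶ M`, hence exists and is preserved by
`T`. -/
theorem isPullback_pullback_square : IsPullback
    (pullback.lift (pullback.fst A.proj (pullback.snd A.proj f ≫ f))
      (pullback.snd A.proj (pullback.snd A.proj f ≫ f) ≫ pullback.snd A.proj f)
      (by rw [pullback.condition, Category.assoc]))
    (pullback.snd A.proj (pullback.snd A.proj f ≫ f))
    (pullback.snd A.proj f) (pullback.snd A.proj f) := by
  refine IsPullback.of_right (h₁₂ := pullback.fst A.proj f) (v₁₃ := A.proj) (h₂₂ := f) ?_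
    (pullback.lift_snd _ _ _) (IsPullback.of_hasPullback A.proj f)
  rw [pullback.lift_fst]
  exact IsPullback.of_hasPullback _ _

instance hasPullback_pullback_square : HasPullback (pullback.snd A.proj f) (pullback.snd A.proj f) :=
  (A.isPullback_pullback_square f).hasPullback

instance preserves_pullback_square :
    PreservesLimit (cospan (pullback.snd A.proj f) (pullback.snd A.proj f)) (T : C ⥤ C) := by
  have h := A.isPullback_pullback_square f
  refine preservesLimit_of_preserves_limit_cone h.isLimit ?_
  refine (isLimitMapConePullbackConeEquiv T h.w).symm ?_
  have h' : IsPullback (T.map (pullback.lift (pullback.fst A.proj (pullback.snd A.proj f ≫ f))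
      (pullback.snd A.proj (pullback.snd A.proj f ≫ f) ≫ pullback.snd A.proj f)
      (by rw [pullback.condition, Category.assoc])))
      (T.map (pullback.snd A.proj (pullback.snd A.proj f ≫ f)))
      (T.map (pullback.snd A.proj f)) (T.map (pullback.snd A.proj f)) := by
    refine IsPullback.of_right (h₁₂ := T.map (pullback.fst A.proj f)) (v₁₃ := T.map A.proj)
      (h₂₂ := T.map f) ?_ ?_ ((IsPullback.of_hasPullback A.proj f).map T)
    · rw [← T.map_comp, ← T.map_comp, pullback.lift_fst]
      exact (IsPullback.of_hasPullback _ _).map T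
    · rw [← T.map_comp, ← T.map_comp, pullback.lift_snd]
  exact h'.isLimit

/-- The operations of the pullback of `A` along `f`, computed in the fibres of `A`. -/
noncomputable def pullbackOps : FibreOps (pullback.snd A.proj f) where
  zero := pullback.lift (f ≫ A.ξ) (𝟙 N) (by simp [A.ξ_proj])
  add := pullback.lift (A.ops.plus (pullback.fst _ _ ≫ pullback.fst _ _)
      (pullback.snd _ _ ≫ pullback.fst _ _) (by
        simp only [Category.assoc, pullback.condition]
        simp only [← Category.assoc, pullback.condition]))
    (pullback.fst _ _ ≫ pullback.snd _ _) (by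
      rw [FibreOps.plus_proj, Category.assoc, pullback.condition, Category.assoc])
  neg := pullback.lift (pullback.fst _ _ ≫ A.ops.neg) (pullback.snd _ _) (by
    rw [Category.assoc, A.ops.neg_proj, pullback.condition])
  zero_proj := pullback.lift_snd _ _ _
  add_proj := pullback.lift_snd _ _ _
  neg_proj := pullback.lift_snd _ _ _

variable {f}

theorem pullback_aux {Z : C} {a b : Z ⟶ pullback A.proj f}
    (h : a ≫ pullback.snd A.proj f = b ≫ pullback.snd A.proj f) :
    (a ≫ pullback.fst A.proj f) ≫ A.proj = (b ≫ pullback.fst A.proj f) ≫ A.proj := by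
  simp only [Category.assoc, pullback.condition]
  simp only [← Category.assoc, h]

theorem pullbackOps_plus_fst {Z : C} (a b : Z ⟶ pullback A.proj f)
    (h : a ≫ pullback.snd A.proj f = b ≫ pullback.snd A.proj f) :
    (A.pullbackOps f).plus a b h ≫ pullback.fst A.proj f =
      A.ops.plus (a ≫ pullback.fst _ _) (b ≫ pullback.fst _ _) (A.pullback_aux h) := by
  unfold FibreOps.plus
  rw [Category.assoc]
  refine (congrArg (_ ≫ ·) (pullback.lift_fst _ _ _)).trans ?_
  rw [FibreOps.comp_plus]
  exact FibreOps.plus_congr _ (pullback.lift_fst_assoc _ _ _ _) (pullback.lift_snd_assoc _ _ _ _) _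

theorem pullbackOps_zero_fst :
    (A.pullbackOps f).zero ≫ pullback.fst A.proj f = f ≫ A.ξ := pullback.lift_fst _ _ _

theorem pullbackOps_neg_fst :
    (A.pullbackOps f).neg ≫ pullback.fst A.proj f = pullback.fst A.proj f ≫ A.ops.neg :=
  pullback.lift_fst _ _ _

variable (f)

/-- The additive bundle on the pullback of `A` along `f`. -/
noncomputable abbrev pullbackAdditive : AdditiveBundle (pullback.snd A.proj f) where
  toFibreOps := A.pullbackOps f
  zero_plus a := by
    apply pullback.hom_ext
    · rw [pullbackOps_plus_fst]
      refine (FibreOps.plus_congr _ ?_ rfl _).trans (A.bundle.zero_plus _)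
      simp only [Category.assoc, pullbackOps_zero_fst]
      rw [← Category.assoc _ f, ← pullback.condition, Category.assoc]
    · rw [FibreOps.plus_proj]
      simp only [Category.assoc, (A.pullbackOps f).zero_proj, Category.comp_id]
  plus_comm a b h := by
    apply pullback.hom_ext
    · rw [pullbackOps_plus_fst, pullbackOps_plus_fst, A.bundle.plus_comm]
    · rw [FibreOps.plus_proj, FibreOps.plus_proj, h]
  plus_assoc a b d h h' := by
    apply pullback.hom_ext
    · rw [pullbackOps_plus_fst, FibreOps.plus_congr _ (A.pullbackOps_plus_fst a b h) rfl,
        A.bundle.plus_assoc _ _ _ _ (A.pullback_aux h'), pullbackOps_plus_fst]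
      exact FibreOps.plus_congr _ rfl (A.pullbackOps_plus_fst b d h').symm _
    · rw [FibreOps.plus_proj, FibreOps.plus_proj, FibreOps.plus_proj]
  neg_plus a := by
    apply pullback.hom_ext
    · rw [pullbackOps_plus_fst]
      have := A.bundle.neg_plus (a ≫ pullback.fst _ _)
      refine (FibreOps.plus_congr _ ?_ rfl _).trans (this.trans ?_)
      · rw [Category.assoc, Category.assoc, pullbackOps_neg_fst]
      · simp only [Category.assoc, pullbackOps_zero_fst]
        rw [← Category.assoc _ f, ← pullback.condition, Category.assoc]
    · rw [FibreOps.plus_proj]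
      simp only [Category.assoc, (A.pullbackOps f).zero_proj, (A.pullbackOps f).neg_proj,
        Category.comp_id]

theorem pullbackAdditive_fst : IsAdditiveHom (A.pullbackAdditive f).toFibreOps A.ops
    (pullback.fst A.proj f) f :=
  IsAdditiveHom.of_plus pullback.condition (A.pullbackOps_zero_fst)
    (fun a b h => A.pullbackOps_plus_fst a b h)

/-- The lift `λ × 0` on the pullback of `A` along `f`. -/
noncomputable def pullbackLift : pullback A.proj f ⟶ T.obj (pullback A.proj f) :=
  ((IsPullback.of_hasPullback A.proj f).map T).lift (pullback.fst _ _ ≫ A.lift)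
    (pullback.snd _ _ ≫ PreTangentCategory.zero N) (by
      rw [Category.assoc, A.lift_Tproj, Category.assoc, ← zero_naturality, ← Category.assoc,
        pullback.condition, Category.assoc])

theorem pullbackLift_fst : A.pullbackLift f ≫ T.map (pullback.fst A.proj f) =
    pullback.fst _ _ ≫ A.lift := IsPullback.lift_fst _ _ _ _

theorem pullbackLift_snd : A.pullbackLift f ≫ T.map (pullback.snd A.proj f) =
    pullback.snd _ _ ≫ PreTangentCategory.zero N := IsPullback.lift_snd _ _ _ _

variable {f}

theorem Tpullback_hom_ext {Z : C} {x y : Z ⟶ T.obj (pullback A.proj f)}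
    (h₁ : x ≫ T.map (pullback.fst A.proj f) = y ≫ T.map (pullback.fst A.proj f))
    (h₂ : x ≫ T.map (pullback.snd A.proj f) = y ≫ T.map (pullback.snd A.proj f)) : x = y :=
  ((IsPullback.of_hasPullback A.proj f).map T).hom_ext h₁ h₂

variable (f)

theorem pullbackLift_additive : IsAdditiveHom (A.pullbackAdditive f).toFibreOps
    ((A.pullbackAdditive f).toFibreOps.map T) (A.pullbackLift f) (PreTangentCategory.zero N) := by
  refine IsAdditiveHom.of_plus (A.pullbackLift_snd f) ?_ ?_
  · change (A.pullbackOps f).zero ≫ _ = _ ≫ T.map (A.pullbackOps f).zero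
    apply Tpullback_hom_ext
    · rw [Category.assoc, pullbackLift_fst, ← Category.assoc, pullbackOps_zero_fst,
        Category.assoc, Category.assoc, ← T.map_comp, pullbackOps_zero_fst, ← zero_naturality,
        A.ξ_lift, Category.assoc]
    · rw [Category.assoc, pullbackLift_snd, ← Category.assoc, (A.pullbackOps f).zero_proj,
        Category.assoc, ← T.map_comp, (A.pullbackOps f).zero_proj, T.map_id, Category.id_comp,
        Category.comp_id]
  · intro Z a b h
    apply Tpullback_hom_ext
    · rw [((A.pullbackAdditive_fst f).map T).plus, Category.assoc, pullbackLift_fst,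
        ← Category.assoc, (A.pullbackAdditive_fst f).plus, A.lift_additive.plus]
      exact FibreOps.plus_congr _ (by simp only [Category.assoc, pullbackLift_fst])
        (by simp only [Category.assoc, pullbackLift_fst]) _
    · rw [FibreOps.plus_proj, Category.assoc, Category.assoc, pullbackLift_snd, ← Category.assoc,
        ← Category.assoc, FibreOps.plus_proj]

theorem pullbackLift_additive' : IsAdditiveHom (A.pullbackAdditive f).toFibreOps
    (tOps (pullback A.proj f)) (A.pullbackLift f) (A.pullbackAdditive f).zero := by
  refine IsAdditiveHom.of_plus ?_ ?_ ?_
  · change _ = _ ≫ (A.pullbackOps f).zero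
    apply pullback.hom_ext
    · rw [Category.assoc, ← p_naturality, ← Category.assoc, pullbackLift_fst, Category.assoc,
        A.lift_p, Category.assoc, pullbackOps_zero_fst, ← Category.assoc, pullback.condition,
        Category.assoc]
    · rw [Category.assoc, ← p_naturality, ← Category.assoc, pullbackLift_snd, Category.assoc,
        zero_p, Category.assoc, (A.pullbackOps f).zero_proj]
  · rw [tOps_zero]
    change (A.pullbackOps f).zero ≫ _ = (A.pullbackOps f).zero ≫ _
    apply Tpullback_hom_ext
    · rw [Category.assoc, pullbackLift_fst, ← Category.assoc, pullbackOps_zero_fst,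
        Category.assoc, Category.assoc, ← zero_naturality,
        ← Category.assoc (A.pullbackOps f).zero, pullbackOps_zero_fst, A.ξ_lift, Category.assoc]
    · rw [Category.assoc, pullbackLift_snd, Category.assoc, zero_naturality]
  · intro Z a b h
    apply Tpullback_hom_ext
    · rw [plus_Tmap, Category.assoc]
      refine (congrArg (_ ≫ ·) (A.pullbackLift_fst f)).trans ?_
      rw [← Category.assoc, (A.pullbackAdditive_fst f).plus, A.lift_additive'.plus]
      exact FibreOps.plus_congr _ (by simp only [Category.assoc, pullbackLift_fst])
        (by simp only [Category.assoc, pullbackLift_fst]) _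
    · rw [plus_Tmap, Category.assoc]
      refine (congrArg (_ ≫ ·) (A.pullbackLift_snd f)).trans ?_
      rw [← Category.assoc, FibreOps.plus_proj]
      have e := zero_plus_zero (a ≫ pullback.snd A.proj f)
      refine (e.symm.trans ?_)
      exact FibreOps.plus_congr _ (by simp only [Category.assoc, pullbackLift_snd])
        (by rw [h]; simp only [Category.assoc, pullbackLift_snd]) _

/-- The map `(a, b) ↦ 0a + λb` of the pullback of `A` along `f`. -/
noncomputable def pullbackMu : pullback (pullback.snd A.proj f) (pullback.snd A.proj f) ⟶
    T.obj (pullback A.proj f) :=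
  ((A.pullbackOps f).map T).plus
    (pullback.fst _ _ ≫ PreTangentCategory.zero (pullback A.proj f))
    (pullback.snd _ _ ≫ A.pullbackLift f) (by
      rw [Category.assoc, Category.assoc, ← zero_naturality, pullbackLift_snd, ← Category.assoc,
        ← Category.assoc, pullback.condition])

theorem pullbackMu_fst : A.pullbackMu f ≫ T.map (pullback.fst A.proj f) =
      pullback.lift (pullback.fst (pullback.snd A.proj f) (pullback.snd A.proj f) ≫
        pullback.fst _ _) (pullback.snd (pullback.snd A.proj f) (pullback.snd A.proj f) ≫
        pullback.fst _ _) (A.pullback_aux pullback.condition) ≫ A.mu := by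
  rw [mu_eq, FibreOps.comp_plus]
  refine (((A.pullbackAdditive_fst f).map T).plus _ _ _).trans ?_
  refine FibreOps.plus_congr _ ?_ ?_ _
  · rw [pullback.lift_fst_assoc, Category.assoc, Category.assoc, ← zero_naturality]
  · rw [pullback.lift_snd_assoc, Category.assoc, Category.assoc, pullbackLift_fst]

theorem pullbackMu_snd : A.pullbackMu f ≫ T.map (pullback.snd A.proj f) =
    pullback.fst _ _ ≫ pullback.snd A.proj f ≫ PreTangentCategory.zero N := by
  unfold pullbackMu
  rw [FibreOps.plus_proj, Category.assoc, zero_naturality]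

theorem pullbackMu_p : A.pullbackMu f ≫ p _ = pullback.fst _ _ := by
  apply pullback.hom_ext
  · rw [Category.assoc, ← p_naturality, ← Category.assoc, pullbackMu_fst, Category.assoc, A.mu_p,
      pullback.lift_fst]
  · rw [Category.assoc, ← p_naturality, ← Category.assoc, pullbackMu_snd, Category.assoc,
      Category.assoc, zero_p, Category.comp_id]

variable {f}

/-- The lift on the pullback of `A` along `f` is universal. -/
theorem existsUnique_comp_pullbackMu {Z : C} (x : Z ⟶ T.obj (pullback A.proj f))
    (hx : x ≫ T.map (pullback.snd A.proj f) =
      x ≫ p (pullback A.proj f) ≫ pullback.snd A.proj f ≫ PreTangentCategory.zero N) :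
    ∃! y : Z ⟶ pullback (pullback.snd A.proj f) (pullback.snd A.proj f),
      y ≫ A.pullbackMu f = x := by
  have hx' : (x ≫ T.map (pullback.fst A.proj f)) ≫ T.map A.proj =
      (x ≫ T.map (pullback.fst A.proj f)) ≫ p A.E ≫ A.proj ≫ PreTangentCategory.zero M := by
    rw [Category.assoc, ← T.map_comp, pullback.condition, T.map_comp, ← Category.assoc, hx]
    simp only [Category.assoc]
    rw [← zero_naturality, ← Category.assoc (T.map _) (p _), p_naturality]
    simp only [Category.assoc]
    rw [← Category.assoc (pullback.fst _ _) A.proj, pullback.condition, Category.assoc]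
  have hd := A.decompose_mu _ hx'
  have hfst : A.decompose _ hx' ≫ pullback.fst _ _ =
      x ≫ p _ ≫ pullback.fst A.proj f := by
    rw [← A.mu_p, ← Category.assoc, hd, Category.assoc, p_naturality]
  have h1 : (A.decompose _ hx' ≫ pullback.fst _ _) ≫ A.proj =
      (x ≫ p _ ≫ pullback.snd A.proj f) ≫ f := by
    rw [hfst]
    simp only [Category.assoc, pullback.condition]
  have h2 : (A.decompose _ hx' ≫ pullback.snd _ _) ≫ A.proj =
      (x ≫ p _ ≫ pullback.snd A.proj f) ≫ f := by
    rw [← h1, Category.assoc, Category.assoc, pullback.condition]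
  have huniq : ∀ y : Z ⟶ pullback (pullback.snd A.proj f) (pullback.snd A.proj f),
      y ≫ A.pullbackMu f = x →
        y ≫ pullback.fst _ _ = x ≫ p _ ∧
        y ≫ pullback.snd _ _ ≫ pullback.fst _ _ = A.decompose _ hx' ≫ pullback.snd _ _ := by
    intro y hy
    refine ⟨?_, ?_⟩
    · rw [← hy, Category.assoc]
      rw [pullbackMu_p]
    · have e : y ≫ pullback.lift (pullback.fst _ _ ≫ pullback.fst _ _)
        (pullback.snd _ _ ≫ pullback.fst _ _) (A.pullback_aux pullback.condition) =
          A.decompose _ hx' := by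
        apply A.mu_hom_ext
        rw [hd, Category.assoc, ← pullbackMu_fst, ← Category.assoc, hy]
      rw [← e, Category.assoc, pullback.lift_snd]
  refine ⟨pullback.lift (pullback.lift _ _ h1) (pullback.lift _ _ h2)
    (by rw [pullback.lift_snd, pullback.lift_snd]), ?_, ?_⟩
  · apply Tpullback_hom_ext
    · rw [Category.assoc, pullbackMu_fst]
      refine Eq.trans ?_ hd
      rw [← Category.assoc]
      congr 1
      apply pullback.hom_ext
      · rw [Category.assoc, pullback.lift_fst, pullback.lift_fst_assoc, pullback.lift_fst]
      · rw [Category.assoc]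
        refine (congrArg (_ ≫ ·) (pullback.lift_snd _ _ _)).trans ?_
        rw [pullback.lift_snd_assoc, pullback.lift_fst]
    · rw [Category.assoc, hx, pullbackMu_snd, pullback.lift_fst_assoc, pullback.lift_snd_assoc]
      simp only [Category.assoc]
  · intro y hy
    obtain ⟨e1, e2⟩ := huniq y hy
    have e3 : y ≫ pullback.snd _ _ ≫ pullback.snd A.proj f = x ≫ p _ ≫ pullback.snd A.proj f := by
      rw [← pullback.condition, ← Category.assoc, e1, Category.assoc]
    apply pullback.hom_ext <;> apply pullback.hom_ext
    · rw [pullback.lift_fst, pullback.lift_fst, e1, hfst, Category.assoc]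
    · rw [pullback.lift_fst, pullback.lift_snd, e1, Category.assoc]
    · rw [pullback.lift_snd, pullback.lift_fst, Category.assoc, e2]
    · rw [pullback.lift_snd, pullback.lift_snd, Category.assoc, e3]

variable (f)

/-- The pullback of the differential bundle `A` along `f`, without the universality of its lift.
The equation `T(λ)λ = lλ` is one between maps into `T²(f^*A)`, whence the hypothesis that `T²`
carries the pullback to a jointly monic pair. -/
noncomputable def pullbackPreBundle
    (hTT : ∀ {Z : C} {x y : Z ⟶ T.obj (T.obj (pullback A.proj f))},
      x ≫ T.map (T.map (pullback.fst A.proj f)) = y ≫ T.map (T.map (pullback.fst A.proj f)) →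
      x ≫ T.map (T.map (pullback.snd A.proj f)) = y ≫ T.map (T.map (pullback.snd A.proj f)) →
      x = y) : PreDifferentialBundle N where
  E := pullback A.proj f
  proj := pullback.snd A.proj f
  bundle := A.pullbackAdditive f
  lift := A.pullbackLift f
  lift_additive := A.pullbackLift_additive f
  lift_additive' := A.pullbackLift_additive' f
  lift_lift := by
    apply hTT
    · simp only [Category.assoc]
      rw [← T.map_comp, pullbackLift_fst, ← l_naturality, T.map_comp, ← Category.assoc,
        ← Category.assoc, pullbackLift_fst, Category.assoc, Category.assoc, A.lift_lift]
    · simp only [Category.assoc]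
      rw [← T.map_comp, pullbackLift_snd, ← l_naturality, T.map_comp, ← Category.assoc,
        ← Category.assoc, pullbackLift_snd, Category.assoc, Category.assoc, ← zero_naturality,
        l_zero]

/-- The pullback of the differential bundle `A` along `f`. -/
noncomputable def pullbackBundle
    (hTT : ∀ {Z : C} {x y : Z ⟶ T.obj (T.obj (pullback A.proj f))},
      x ≫ T.map (T.map (pullback.fst A.proj f)) = y ≫ T.map (T.map (pullback.fst A.proj f)) →
      x ≫ T.map (T.map (pullback.snd A.proj f)) = y ≫ T.map (T.map (pullback.snd A.proj f)) →
      x = y) : DifferentialBundle N where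
  toPreDifferentialBundle := A.pullbackPreBundle f hTT
  universal :=
    ⟨Fork.IsLimit.mk _
      (fun s => (A.existsUnique_comp_pullbackMu (f := f) s.ι s.condition).choose)
      (fun s => (A.existsUnique_comp_pullbackMu (f := f) s.ι s.condition).choose_spec.1)
      (fun s m hm =>
        (A.existsUnique_comp_pullbackMu (f := f) s.ι s.condition).choose_spec.2 m hm)⟩

end Pullback

end DifferentialBundle

/-- `T²` preserves the pullbacks of `p`, because `c` identifies `T(p)` with `p`. -/
theorem TTpullback_hom_ext [HasSubstitution C] {N : C} (f : N ⟶ M) {Z : C}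
    {x y : Z ⟶ T.obj (T.obj (pullback (tangentBundle M).proj f))}
    (h₁ : x ≫ T.map (T.map (pullback.fst (tangentBundle M).proj f)) =
      y ≫ T.map (T.map (pullback.fst (tangentBundle M).proj f)))
    (h₂ : x ≫ T.map (T.map (pullback.snd (tangentBundle M).proj f)) =
      y ≫ T.map (T.map (pullback.snd (tangentBundle M).proj f))) : x = y := by
  have h := (IsPullback.of_hasPullback (tangentBundle M).proj f).map T
  have hc : IsPullback (T.map (pullback.fst (tangentBundle M).proj f) ≫ c M)
      (T.map (pullback.snd (tangentBundle M).proj f)) (p (T.obj M))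
      (T.map f) := by
    refine h.of_iso (Iso.refl _) ⟨c M, c M, c_c M, c_c M⟩ (Iso.refl _) (Iso.refl _) ?_ ?_ ?_ ?_
    · exact (Category.id_comp _).symm
    · exact (Category.comp_id _).trans (Category.id_comp _).symm
    · exact (Category.comp_id _).trans (c_p M).symm
    · exact (Category.comp_id _).trans (Category.id_comp _).symm
  have : PreservesLimit (cospan (p (T.obj M)) (T.map f)) (T : C ⥤ C) :=
    HasSubstitution.preserves (tangentBundle (T.obj M)) (T.map f)
  refine (hc.map T).hom_ext ?_ h₂
  have e : T.map (T.map (pullback.fst (tangentBundle M).proj f) ≫ c M) =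
      T.map (T.map (pullback.fst (tangentBundle M).proj f)) ≫ T.map (c M) := T.map_comp _ _
  exact (congrArg (x ≫ ·) e).trans ((Category.assoc _ _ _).symm.trans
    ((congrArg (· ≫ T.map (c M)) h₁).trans ((Category.assoc _ _ _).trans
      (congrArg (y ≫ ·) e.symm))))

end Bundles

/-! ### Scalar multiplication -/

section Scalars

open PreTangentCategory

variable {C : Type u} [Category.{v} C] [TangentCategory C] {M : C}

/-- The lift of a differential bundle is a linear morphism to the tangent bundle of its total
space. -/
theorem DifferentialBundle.lift_linear (A : DifferentialBundle M) :
    IsLinearHom A (tangentBundle A.E) A.lift A.ξ :=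
  ⟨A.lift_p, A.lift_lift.symm⟩

theorem Tmap_linear {M N : C} (f : M ⟶ N) :
    IsLinearHom (tangentBundle M) (tangentBundle N) (T.map f) f :=
  ⟨p_naturality f, l_naturality f⟩

variable [HasFiniteProducts C] [PreservesFiniteProducts (T : C ⥤ C)]

theorem prodT_fst {X Y Z : C} (x : Z ⟶ T.obj X) (y : Z ⟶ T.obj Y) :
    prodT x y ≫ T.map prod.fst = x := by
  rw [prodT, Category.assoc, PreservesLimitPair.iso_inv_fst, prod.lift_fst]

theorem prodT_snd {X Y Z : C} (x : Z ⟶ T.obj X) (y : Z ⟶ T.obj Y) :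
    prodT x y ≫ T.map prod.snd = y := by
  rw [prodT, Category.assoc, PreservesLimitPair.iso_inv_snd, prod.lift_snd]

theorem Tprod_hom_ext {X Y Z : C} {x y : Z ⟶ T.obj (X ⨯ Y)}
    (h₁ : x ≫ T.map prod.fst = y ≫ T.map prod.fst)
    (h₂ : x ≫ T.map prod.snd = y ≫ T.map prod.snd) : x = y := by
  rw [← cancel_mono (PreservesLimitPair.iso (T : C ⥤ C) X Y).hom]
  apply Limits.prod.hom_ext <;> simpa

theorem comp_prodT {W X Y Z : C} (g : W ⟶ Z) (x : Z ⟶ T.obj X) (y : Z ⟶ T.obj Y) :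
    g ≫ prodT x y = prodT (g ≫ x) (g ≫ y) := by
  apply Tprod_hom_ext <;> simp only [Category.assoc, prodT_fst, prodT_snd]

theorem comp_Tlift {W X Y Z : C} (g : Z ⟶ T.obj W) (x : W ⟶ X) (y : W ⟶ Y) :
    g ≫ T.map (prod.lift x y) = prodT (g ≫ T.map x) (g ≫ T.map y) := by
  apply Tprod_hom_ext
  · rw [Category.assoc, ← T.map_comp, prod.lift_fst, prodT_fst]
  · rw [Category.assoc, ← T.map_comp, prod.lift_snd, prodT_snd]

theorem prodT_plus {X Y Z : C} (x x' : Z ⟶ T.obj X) (y y' : Z ⟶ T.obj Y)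
    (h : x ≫ p X = x' ≫ p X) (h' : y ≫ p Y = y' ≫ p Y) :
    prodT ((tOps X).plus x x' h) ((tOps Y).plus y y' h') =
      (tOps (X ⨯ Y)).plus (prodT x y) (prodT x' y') (by rw [prodT_p, prodT_p, h, h']) := by
  apply Tprod_hom_ext
  · rw [prodT_fst, plus_Tmap]
    exact FibreOps.plus_congr _ (prodT_fst _ _).symm (prodT_fst _ _).symm _
  · rw [prodT_snd, plus_Tmap]
    exact FibreOps.plus_congr _ (prodT_snd _ _).symm (prodT_snd _ _).symm _

/-- Every vector `x` tangent to a differential object is `0 p(x) +_T λ(p̂(x))`. -/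
theorem phat_decomposition (R : DifferentialObject C) {Z : C} (x : Z ⟶ T.obj R.E) :
    R.Tops.plus (x ≫ p R.E ≫ PreTangentCategory.zero R.E) ((x ≫ phat R) ≫ R.lift)
      ((terminalIsTerminal.isTerminalObj (T : C ⥤ C)).hom_ext _ _) = x := by
  have h : 𝟙 (T.obj R.E) ≫ T.map R.proj =
      𝟙 (T.obj R.E) ≫ p R.E ≫ R.proj ≫ PreTangentCategory.zero (⊤_ C) :=
    (terminalIsTerminal.isTerminalObj (T : C ⥤ C)).hom_ext _ _
  have hd := R.decompose_mu _ h
  have h1 : p R.E = R.decompose _ h ≫ pullback.fst _ _ := by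
    rw [← R.mu_p, ← Category.assoc, hd, Category.id_comp]
  have h2 : phat R = R.decompose _ h ≫ pullback.snd _ _ := rfl
  have e : x ≫ R.decompose _ h ≫ R.mu = x := by rw [hd, Category.comp_id]
  rw [R.mu_eq, FibreOps.comp_plus, FibreOps.comp_plus] at e
  refine (FibreOps.plus_congr _ ?_ ?_ _).trans e
  · rw [h1, Category.assoc]
  · rw [h2, Category.assoc, Category.assoc]

namespace IsScalarExtension

variable {R : DifferentialObject C} {u : ⊤_ C ⟶ R.E} {A : DifferentialBundle M} {P : C}
  {f : P ⟶ A.E} {g : R.E ⨯ P ⟶ A.E}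

/-- Composition with a linear morphism preserves extensions along the unit point. -/
theorem comp_linear {N : C} {B : DifferentialBundle N} {φ : A.E ⟶ B.E} {b : M ⟶ N}
    (h : IsScalarExtension R u A f g) (H : IsLinearHom A B φ b) :
    IsScalarExtension R u B (f ≫ φ) (g ≫ φ) where
  proj := by
    rw [Category.assoc, Category.assoc, H.w, ← Category.assoc, h.proj]
    simp only [Category.assoc]
  unit := by rw [← Category.assoc, h.unit]
  linear := by
    rw [Category.assoc, H.lift, ← Category.assoc, h.linear, Category.assoc, T.map_comp]

theorem precomp (h : IsScalarExtension R u A f g) {Q : C} (k : Q ⟶ P) :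
    IsScalarExtension R u A (k ≫ f) (prod.lift prod.fst (prod.snd ≫ k) ≫ g) where
  proj := by rw [Category.assoc, h.proj, prod.lift_snd_assoc]; simp only [Category.assoc]
  unit := by
    rw [← h.unit, ← Category.assoc, ← Category.assoc]
    congr 1
    apply Limits.prod.hom_ext
    · simp only [Category.assoc, prod.lift_fst]
      rw [← Category.assoc k]
      congr 1
      exact terminalIsTerminal.hom_ext _ _
    · simp only [Category.assoc, prod.lift_snd, prod.lift_snd_assoc, Category.comp_id,
        Category.id_comp]
  linear := by
    rw [Category.assoc, h.linear, ← Category.assoc, comp_prodT, prod.lift_fst_assoc,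
      prod.lift_snd_assoc, T.map_comp, ← Category.assoc, comp_Tlift, prodT_fst, T.map_comp]
    congr 2
    rw [← Category.assoc _ (T.map prod.snd), prodT_snd, Category.assoc, Category.assoc,
      zero_naturality]

end IsScalarExtension

variable [HasSubstitution C]

namespace PreUnitObject

variable (U : PreUnitObject C)

/-- An extension of `f : Z ⟶ A` along the point `u` that is linear in the scalar is unique, for an
arbitrary object `Z`, if `A` can be pulled back along `Z ⟶ M` as a differential bundle: it is an
extension of a section of that pullback, and `R` is a unit among the differential bundles over
`Z`. -/
theorem scalarExtension_unique_of_TT {A : DifferentialBundle M} {Z : C} {f : Z ⟶ A.E}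
    (hTT : ∀ {W : C} {x y : W ⟶ T.obj (T.obj (pullback A.proj (f ≫ A.proj)))},
      x ≫ T.map (T.map (pullback.fst A.proj (f ≫ A.proj))) =
        y ≫ T.map (T.map (pullback.fst A.proj (f ≫ A.proj))) →
      x ≫ T.map (T.map (pullback.snd A.proj (f ≫ A.proj))) =
        y ≫ T.map (T.map (pullback.snd A.proj (f ≫ A.proj))) → x = y)
    {g g' : U.R.E ⨯ Z ⟶ A.E} (h : IsScalarExtension U.R U.u A f g)
    (h' : IsScalarExtension U.R U.u A f g') : g = g' := by
  let B : DifferentialBundle Z := A.pullbackBundle (f ≫ A.proj) hTT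
  have hf : f ≫ A.proj = 𝟙 Z ≫ f ≫ A.proj := (Category.id_comp _).symm
  let f' : Z ⟶ pullback A.proj (f ≫ A.proj) :=
    pullback.lift f (𝟙 Z) hf
  -- an extension `k` of `f` gives an extension `(k, id)` of the section `(f, id)`
  have key : ∀ {k : U.R.E ⨯ Z ⟶ A.E} (hk : IsScalarExtension U.R U.u A f k),
      IsScalarExtension U.R U.u B f' (pullback.lift k prod.snd hk.proj) := by
    intro k hk
    refine ⟨?_, ?_, ?_⟩
    · change pullback.lift k prod.snd hk.proj ≫ pullback.snd _ _ =
        prod.snd ≫ pullback.lift f (𝟙 Z) hf ≫ pullback.snd _ _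
      rw [pullback.lift_snd, pullback.lift_snd, Category.comp_id]
    · change prod.lift (terminal.from Z ≫ U.u) (𝟙 Z) ≫ pullback.lift k prod.snd hk.proj =
        pullback.lift f (𝟙 Z) hf
      apply pullback.hom_ext
      · rw [Category.assoc, pullback.lift_fst, pullback.lift_fst]
        exact hk.unit
      · rw [Category.assoc, pullback.lift_snd, pullback.lift_snd, prod.lift_snd]
    · change pullback.lift k prod.snd hk.proj ≫ A.pullbackLift _ =
        prodT (prod.fst ≫ U.R.lift) (prod.snd ≫ PreTangentCategory.zero Z) ≫
          T.map (pullback.lift k prod.snd hk.proj)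
      apply DifferentialBundle.Tpullback_hom_ext
      · rw [Category.assoc, DifferentialBundle.pullbackLift_fst, pullback.lift_fst_assoc,
          Category.assoc, ← T.map_comp, pullback.lift_fst]
        exact hk.linear
      · rw [Category.assoc, DifferentialBundle.pullbackLift_snd, pullback.lift_snd_assoc,
          Category.assoc, ← T.map_comp, pullback.lift_snd, prodT_snd]
  have hP : IsPullback (𝟙 Z) (𝟙 Z) (trivialBundle Z).proj (trivialBundle Z).proj :=
    trivial_isPullback (trivialBundle Z)
  have hu := (U.isUnit Z (trivialBundle Z) (trivialBundle Z) B (𝟙 Z) (𝟙 Z) hP f'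
    ((pullback.lift_snd _ _ _).trans (Category.comp_id _).symm)).1.unique (key h) (key h')
  have := congrArg (· ≫ pullback.fst _ _) hu
  simpa only [pullback.lift_fst] using this

/-- An extension of `f : Z ⟶ A` along `u` that is linear in the scalar is unique, for an arbitrary
object `Z`; composition with the lift of `A` reduces this to tangent bundles. -/
theorem scalarExtension_unique {A : DifferentialBundle M} {Z : C} {f : Z ⟶ A.E}
    {g g' : U.R.E ⨯ Z ⟶ A.E} (h : IsScalarExtension U.R U.u A f g)
    (h' : IsScalarExtension U.R U.u A f g') : g = g' :=
  A.lift_cancel (U.scalarExtension_unique_of_TT (TTpullback_hom_ext _) (h.comp_linear A.lift_linear)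
    (h'.comp_linear A.lift_linear))

/-- Every extension that is linear in the scalar is given by scalar multiplication. -/
theorem lift_scalarExtension {A : DifferentialBundle M} {P Z : C} {f : P ⟶ A.E}
    {g : U.R.E ⨯ P ⟶ A.E} (h : IsScalarExtension U.R U.u A f g) (r : Z ⟶ U.R.E) (x : Z ⟶ P) :
    prod.lift r x ≫ g = U.act A r (x ≫ f) := by
  have h' := (U.smul_spec A).precomp f
  rw [Category.comp_id] at h'
  rw [U.scalarExtension_unique h h', act, ← Category.assoc]
  congr 1
  rw [prod.comp_lift, prod.lift_fst, prod.lift_snd_assoc]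

/-- Linear morphisms of differential bundles preserve scalar multiplication. -/
theorem act_comp_linear {N : C} {A : DifferentialBundle M} {B : DifferentialBundle N}
    {φ : A.E ⟶ B.E} {b : M ⟶ N} (H : IsLinearHom A B φ b) {Z : C} (r : Z ⟶ U.R.E)
    (a : Z ⟶ A.E) : U.act A r a ≫ φ = U.act B r (a ≫ φ) := by
  have h := U.lift_scalarExtension ((U.smul_spec A).comp_linear H) r a
  rw [Category.id_comp] at h
  rw [← h, act, Category.assoc]

theorem act_congr (A : DifferentialBundle M) {Z : C} {r r' : Z ⟶ U.R.E} {a a' : Z ⟶ A.E}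
    (hr : r = r') (ha : a = a') : U.act A r a = U.act A r' a' := by
  rw [hr, ha]

/-- Linearity of scalar multiplication in the scalar. -/
theorem act_lift (A : DifferentialBundle M) {Z : C} (r : Z ⟶ U.R.E) (a : Z ⟶ A.E) :
    U.act A r a ≫ A.lift =
      prodT (r ≫ U.R.lift) (a ≫ PreTangentCategory.zero A.E) ≫ T.map (U.smul A) := by
  rw [act, Category.assoc, (U.smul_spec A).linear, ← Category.assoc, comp_prodT,
    prod.lift_fst_assoc, prod.lift_snd_assoc]

/-- Linearity of scalar multiplication in the vector. -/
theorem act_lift' (A : DifferentialBundle M) {Z : C} (r : Z ⟶ U.R.E) (a : Z ⟶ A.E) :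
    U.act A r a ≫ A.lift =
      prodT (r ≫ PreTangentCategory.zero U.R.E) (a ≫ A.lift) ≫ T.map (U.smul A) := by
  have hs : sndLift (V := trivialBundle M) (W := A) (trivial_isPullback A) = A.lift := by
    have : sndLift (V := trivialBundle M) (W := A) (trivial_isPullback A) ≫ T.map (𝟙 A.E) = 𝟙 A.E ≫ A.lift :=
      IsPullback.lift_snd _ _ _ _
    simpa only [T.map_id, Category.comp_id, Category.id_comp] using this
  have h := (U.isUnit M (trivialBundle M) A A A.proj (𝟙 A.E) (trivial_isPullback A) (𝟙 A.E)
    (Category.id_comp _ |>.trans (Category.comp_id _).symm)).2 _ (U.smul_spec A)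
    (by rw [hs, T.map_id, Category.id_comp, Category.comp_id])
  rw [act, Category.assoc, h, hs, ← Category.assoc, comp_prodT, prod.lift_fst_assoc,
    prod.lift_snd_assoc]

/-- Scalar multiplication is additive in the scalar, because it is linear in the scalar. -/
theorem act_plus_left (A : DifferentialBundle M) {Z : C} (r s : Z ⟶ U.R.E)
    (h : r ≫ U.R.proj = s ≫ U.R.proj) (a : Z ⟶ A.E) :
    U.act A (U.R.ops.plus r s h) a =
      A.ops.plus (U.act A r a) (U.act A s a) (by rw [act_proj, act_proj]) := by
  apply A.lift_cancel
  rw [act_lift, U.R.lift_additive'.plus, ← zero_plus_zero, prodT_plus, plus_Tmap,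
    A.lift_additive'.plus]
  exact FibreOps.plus_congr _ (U.act_lift A r a).symm (U.act_lift A s a).symm _

theorem act_plus_right (A : DifferentialBundle M) {Z : C} (r : Z ⟶ U.R.E) (a b : Z ⟶ A.E)
    (h : a ≫ A.proj = b ≫ A.proj) :
    U.act A r (A.ops.plus a b h) =
      A.ops.plus (U.act A r a) (U.act A r b) (by rw [act_proj, act_proj, h]) := by
  apply A.lift_cancel
  rw [act_lift', A.lift_additive'.plus, ← zero_plus_zero, prodT_plus, plus_Tmap,
    A.lift_additive'.plus]
  exact FibreOps.plus_congr _ (U.act_lift' A r a).symm (U.act_lift' A r b).symm _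

theorem act_minus_right (A : DifferentialBundle M) {Z : C} (r : Z ⟶ U.R.E) (a b : Z ⟶ A.E)
    (h : a ≫ A.proj = b ≫ A.proj) :
    U.act A r (A.ops.minus a b h) =
      A.ops.minus (U.act A r a) (U.act A r b) (by rw [act_proj, act_proj, h]) := by
  apply A.bundle.eq_minus_of_plus_eq (by rw [act_proj, act_proj, FibreOps.minus_proj, h])
  rw [← act_plus_right _ _ _ _ _ (by rw [FibreOps.minus_proj, h]), A.bundle.minus_plus_cancel]

/-- Scalar multiples of zero vectors are zero: `prod.snd ≫ 0` is a linear extension of `0`. -/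
theorem act_zero (E : C) {Z : C} (r : Z ⟶ U.R.E) (a : Z ⟶ E) :
    U.act (tangentBundle E) r (a ≫ PreTangentCategory.zero E) =
      a ≫ PreTangentCategory.zero E := by
  have h : IsScalarExtension U.R U.u (tangentBundle E) (PreTangentCategory.zero E)
      (prod.snd ≫ PreTangentCategory.zero E) := by
    refine ⟨Category.assoc _ _ _, prod.lift_snd_assoc _ _ _ |>.trans (Category.id_comp _), ?_⟩
    change (prod.snd ≫ PreTangentCategory.zero E) ≫ l E =
      _ ≫ T.map (prod.snd ≫ PreTangentCategory.zero E : U.R.E ⨯ E ⟶ T.obj E)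
    rw [Category.assoc, l_zero, T.map_comp, ← Category.assoc (prodT _ _), prodT_snd,
      Category.assoc, ← zero_naturality]
  exact (U.lift_scalarExtension h r a).symm.trans (prod.lift_snd_assoc _ _ _)

/-- `r •_p (λd +_{T(π)} 0a) = λ(r • d) +_{T(π)} 0a`: the addition, the zero section and the lift are
compatible with scalar multiplication. -/
theorem act_zero_plus_lift (A : DifferentialBundle M) {Z : C} (r : Z ⟶ U.R.E) (a d : Z ⟶ A.E)
    (h : (d ≫ A.lift) ≫ T.map A.proj = (a ≫ PreTangentCategory.zero A.E) ≫ T.map A.proj)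
    (h' : (U.act A r d ≫ A.lift) ≫ T.map A.proj =
      (a ≫ PreTangentCategory.zero A.E) ≫ T.map A.proj) :
    U.act (tangentBundle A.E) r
        (A.Tops.plus (d ≫ A.lift) (a ≫ PreTangentCategory.zero A.E) h) =
      A.Tops.plus (U.act A r d ≫ A.lift) (a ≫ PreTangentCategory.zero A.E) h' := by
  -- `T` of the addition and of the two projections of `A ×_M A` are linear, so that `r •_p` may be
  -- computed componentwise in `T(A ×_M A)`
  obtain ⟨t, h₁, h₂⟩ := FibreOps.exists_pair T _ _ h
  have e₁ := A.ops.map_plus_comp T t _ _ pullback.condition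
  have e₂ := A.ops.map_plus_comp T (U.act (tangentBundle _) r t) _ _ pullback.condition
  rw [FibreOps.plus_congr _ h₁ h₂] at e₁
  rw [e₁]
  refine (U.act_comp_linear (Tmap_linear _) r t).symm.trans (e₂.symm.trans ?_)
  refine FibreOps.plus_congr _ ?_ ?_ _
  · refine (U.act_comp_linear (Tmap_linear _) r t).trans ?_
    exact (U.act_congr _ rfl h₁).trans (U.act_comp_linear A.lift_linear r d).symm
  · refine (U.act_comp_linear (Tmap_linear _) r t).trans ?_
    exact (U.act_congr _ rfl h₂).trans (U.act_zero A.E r a)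

/-- The image under `T` of the additivity of scalar multiplication in the scalar. -/
theorem prodT_plus_smul (A : DifferentialBundle M) {Z : C} (x y : Z ⟶ T.obj U.R.E)
    (h : x ≫ T.map U.R.proj = y ≫ T.map U.R.proj) (w : Z ⟶ T.obj A.E)
    (h' : (prodT x w ≫ T.map (U.smul A)) ≫ T.map A.proj =
      (prodT y w ≫ T.map (U.smul A)) ≫ T.map A.proj) :
    prodT (U.R.Tops.plus x y h) w ≫ T.map (U.smul A) =
      A.Tops.plus (prodT x w ≫ T.map (U.smul A)) (prodT y w ≫ T.map (U.smul A)) h' := by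
  obtain ⟨t, rfl, rfl⟩ := FibreOps.exists_pair T x y h
  have hc : (prod.fst ≫ pullback.fst U.R.proj U.R.proj : _ ⨯ A.E ⟶ _) ≫ U.R.proj =
      (prod.fst ≫ pullback.snd U.R.proj U.R.proj) ≫ U.R.proj := by
    rw [Category.assoc, Category.assoc, pullback.condition]
  have hr : ∀ r : pullback U.R.proj U.R.proj ⟶ U.R.E,
      prodT (t ≫ T.map r) w ≫ T.map (U.smul A) =
        prodT t w ≫ T.map (U.act A (prod.fst ≫ r) prod.snd) := by
    intro r
    rw [act, T.map_comp, ← Category.assoc (prodT t w), comp_Tlift, prodT_snd, T.map_comp,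
      ← Category.assoc (prodT t w), prodT_fst]
  have e := A.ops.map_plus_comp T (prodT t w)
    (U.act A (prod.fst ≫ pullback.fst U.R.proj U.R.proj) prod.snd)
    (U.act A (prod.fst ≫ pullback.snd U.R.proj U.R.proj) prod.snd)
    (by rw [act_proj, act_proj])
  refine Eq.trans ?_ (FibreOps.plus_congr _ (hr _) (hr _) _).symm
  refine Eq.trans ?_ e.symm
  rw [← U.act_plus_left A _ _ hc, ← FibreOps.comp_plus _ _ _ _ pullback.condition, ← hr,
    U.R.ops.map_plus_comp T _ _ _ pullback.condition]

end PreUnitObject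

end Scalars

/-! ### The involution of an algebroid -/

section Algebroid

open PreTangentCategory

variable {C : Type u} [Category.{v} C] [TangentCategory C] {M : C}

namespace PreInvolutionAlgebroid

variable (A : PreInvolutionAlgebroid M)

theorem prolT_fst {Z : C} (x : Z ⟶ T.obj A.E) (y : Z ⟶ T.obj (T.obj A.E))
    (h : x ≫ T.map A.ρ = y ≫ T.map (T.map A.proj)) :
    A.prolT x y h ≫ T.map (pullback.fst A.ρ (T.map A.proj)) = x :=
  IsPullback.lift_fst _ _ _ _

theorem prolT_snd {Z : C} (x : Z ⟶ T.obj A.E) (y : Z ⟶ T.obj (T.obj A.E))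
    (h : x ≫ T.map A.ρ = y ≫ T.map (T.map A.proj)) :
    A.prolT x y h ≫ T.map (pullback.snd A.ρ (T.map A.proj)) = y :=
  IsPullback.lift_snd _ _ _ _

variable {A} in
theorem prolT_hom_ext {Z : C} {x y : Z ⟶ T.obj (pullback A.ρ (T.map A.proj))}
    (h₁ : x ≫ T.map (pullback.fst _ _) = y ≫ T.map (pullback.fst _ _))
    (h₂ : x ≫ T.map (pullback.snd _ _) = y ≫ T.map (pullback.snd _ _)) : x = y :=
  ((IsPullback.of_hasPullback A.ρ (T.map A.proj)).map T).hom_ext h₁ h₂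

theorem app_congr {Z : C} {v v' : Z ⟶ A.E} {w w' : Z ⟶ T.obj A.E} (hv : v = v') (hw : w = w')
    (h : v ≫ A.ρ = w ≫ T.map A.proj) : A.app v w h = A.app v' w' (by rw [← hv, ← hw, h]) := by
  subst hv hw; rfl

theorem Tapp_congr {Z : C} {x x' : Z ⟶ T.obj A.E} {y y' : Z ⟶ T.obj (T.obj A.E)} (hx : x = x')
    (hy : y = y') (h : x ≫ T.map A.ρ = y ≫ T.map (T.map A.proj)) :
    A.Tapp x y h = A.Tapp x' y' (by rw [← hx, ← hy, h]) := by
  subst hx hy; rfl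

theorem comp_app {Z W : C} (k : W ⟶ Z) (v : Z ⟶ A.E) (w : Z ⟶ T.obj A.E)
    (h : v ≫ A.ρ = w ≫ T.map A.proj) :
    k ≫ A.app v w h = A.app (k ≫ v) (k ≫ w) (by simp only [Category.assoc, h]) := by
  rw [app, app, ← Category.assoc]
  congr 1
  apply pullback.hom_ext <;> simp only [Category.assoc, pullback.lift_fst, pullback.lift_snd]

theorem comp_Tmap_app {Z W : C} (k : W ⟶ T.obj Z) (v : Z ⟶ A.E) (w : Z ⟶ T.obj A.E)
    (h : v ≫ A.ρ = w ≫ T.map A.proj) :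
    k ≫ T.map (A.app v w h) = A.Tapp (k ≫ T.map v) (k ≫ T.map w)
      (by simp only [Category.assoc, ← T.map_comp, h]) := by
  rw [app, Tapp, T.map_comp, ← Category.assoc]
  congr 1
  apply prolT_hom_ext
  · rw [prolT_fst, Category.assoc, ← T.map_comp, pullback.lift_fst]
  · rw [prolT_snd, Category.assoc, ← T.map_comp, pullback.lift_snd]

theorem Tapp_plus {Z : C} (x x' : Z ⟶ T.obj A.E) (y y' : Z ⟶ T.obj (T.obj A.E))
    (h : x ≫ T.map A.ρ = y ≫ T.map (T.map A.proj))
    (h' : x' ≫ T.map A.ρ = y' ≫ T.map (T.map A.proj))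
    (k : x ≫ p _ = x' ≫ p _) (k' : y ≫ p _ = y' ≫ p _) :
    A.Tapp ((tOps _).plus x x' k) ((tOps _).plus y y' k')
        (by rw [plus_Tmap, plus_Tmap]; exact FibreOps.plus_congr _ h h' _) =
      (tOps _).plus (A.Tapp x y h) (A.Tapp x' y' h') (by
        simp only [Tapp, Category.assoc, p_naturality]
        simp only [← Category.assoc]
        congr 1
        apply pullback.hom_ext
        · simp only [Category.assoc, ← p_naturality]
          rw [← Category.assoc, ← Category.assoc, prolT_fst, prolT_fst, k]
        · simp only [Category.assoc, ← p_naturality]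
          rw [← Category.assoc, ← Category.assoc, prolT_snd, prolT_snd, k']) := by
  have hp : A.prolT x y h ≫ p _ = A.prolT x' y' h' ≫ p _ := by
    apply pullback.hom_ext
    · simp only [Category.assoc, ← p_naturality]
      rw [← Category.assoc, ← Category.assoc, prolT_fst, prolT_fst, k]
    · simp only [Category.assoc, ← p_naturality]
      rw [← Category.assoc, ← Category.assoc, prolT_snd, prolT_snd, k']
  refine Eq.trans ?_ (plus_Tmap A.α _ _ hp)
  rw [Tapp]
  congr 1
  apply prolT_hom_ext
  · rw [prolT_fst, plus_Tmap]
    exact FibreOps.plus_congr _ (A.prolT_fst _ _ _).symm (A.prolT_fst _ _ _).symm _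
  · rw [prolT_snd, plus_Tmap]
    exact FibreOps.plus_congr _ (A.prolT_snd _ _ _).symm (A.prolT_snd _ _ _).symm _

/-- The linearity of `α` from `π₀` to `p`, on generalised elements. -/
theorem app_l {Z : C} (v : Z ⟶ A.E) (w : Z ⟶ T.obj A.E) (h : v ≫ A.ρ = w ≫ T.map A.proj)
    (h' : (v ≫ PreTangentCategory.zero A.E) ≫ T.map A.ρ =
      (w ≫ T.map A.lift ≫ c A.E) ≫ T.map (T.map A.proj)) :
    A.app v w h ≫ l A.E = A.Tapp (v ≫ PreTangentCategory.zero A.E)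
      (w ≫ T.map A.lift ≫ c A.E) h' := by
  rw [app, Category.assoc, A.α_l, ← Category.assoc, Tapp]
  congr 1
  apply prolT_hom_ext
  · rw [prolT_fst, Category.assoc]
    refine (congrArg (_ ≫ ·) (A.prolT_fst _ _ _)).trans ?_
    rw [pullback.lift_fst_assoc]
  · rw [prolT_snd, Category.assoc]
    refine (congrArg (_ ≫ ·) (A.prolT_snd _ _ _)).trans ?_
    rw [pullback.lift_snd_assoc]

theorem app_l_aux {Z : C} {v : Z ⟶ A.E} {w : Z ⟶ T.obj A.E}
    (h : v ≫ A.ρ = w ≫ T.map A.proj) :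
    (v ≫ PreTangentCategory.zero A.E) ≫ T.map A.ρ =
      (w ≫ T.map A.lift ≫ c A.E) ≫ T.map (T.map A.proj) := by
  simp only [Category.assoc]
  rw [← zero_naturality, ← c_naturality, ← Category.assoc (T.map A.lift), ← T.map_comp,
    A.lift_Tproj, T.map_comp, Category.assoc, T_zero_c, ← Category.assoc, h, Category.assoc]

/-- The linearity of `α` from `pπ₁` to `T(π)`, on generalised elements. -/
theorem app_c {Z : C} (v : Z ⟶ A.E) (w : Z ⟶ T.obj A.E) (h : v ≫ A.ρ = w ≫ T.map A.proj)
    (h' : (v ≫ A.lift) ≫ T.map A.ρ = (w ≫ l A.E) ≫ T.map (T.map A.proj)) :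
    A.app v w h ≫ T.map A.lift ≫ c A.E = A.Tapp (v ≫ A.lift) (w ≫ l A.E) h' := by
  rw [app, Category.assoc, A.α_c, ← Category.assoc, Tapp]
  congr 1
  apply prolT_hom_ext
  · rw [prolT_fst, Category.assoc]
    refine (congrArg (_ ≫ ·) (A.prolT_fst _ _ _)).trans ?_
    rw [pullback.lift_fst_assoc]
  · rw [prolT_snd, Category.assoc]
    refine (congrArg (_ ≫ ·) (A.prolT_snd _ _ _)).trans ?_
    rw [pullback.lift_snd_assoc]

theorem app_c_aux {Z : C} {v : Z ⟶ A.E} {w : Z ⟶ T.obj A.E}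
    (h : v ≫ A.ρ = w ≫ T.map A.proj) :
    (v ≫ A.lift) ≫ T.map A.ρ = (w ≫ l A.E) ≫ T.map (T.map A.proj) := by
  rw [Category.assoc, Category.assoc, ← A.ρ_l, ← l_naturality, ← Category.assoc, h,
    Category.assoc]

/-- `α(v, 0) = 0v`, where `0` is a zero vector of `T(A) ⟶ T(M)`. -/
theorem app_Tξ {Z : C} (v : Z ⟶ A.E) (h : v ≫ A.ρ = (v ≫ A.ρ ≫ T.map A.ξ) ≫ T.map A.proj) :
    A.app v (v ≫ A.ρ ≫ T.map A.ξ) h = v ≫ PreTangentCategory.zero A.E := by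
  have e : A.app v (v ≫ A.ρ ≫ T.map A.ξ) h ≫ l A.E =
      A.app v (v ≫ A.ρ ≫ T.map A.ξ) h ≫ PreTangentCategory.zero (T.obj A.E) := by
    rw [A.app_l v _ h (A.app_l_aux h), zero_naturality (A.app _ _ h), comp_Tmap_app]
    refine A.Tapp_congr (zero_naturality v) ?_ _
    rw [← zero_naturality]
    simp only [Category.assoc]
    rw [← Category.assoc (T.map A.ξ), ← T.map_comp, A.ξ_lift, T.map_comp, Category.assoc,
      T_zero_c]
  -- an element on which `l` and `0` agree is a zero vector
  have e' := congrArg (· ≫ p (T.obj A.E)) e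
  simp only [Category.assoc, l_p, zero_p, Category.comp_id] at e'
  rw [← e', ← Category.assoc, A.app_p]

/-- `α(v, w +_{T(π)} w') = α(v, w) +_p α(v, w')`. -/
theorem app_plus_right {Z : C} (v : Z ⟶ A.E) (w w' : Z ⟶ T.obj A.E)
    (h : v ≫ A.ρ = w ≫ T.map A.proj) (h' : v ≫ A.ρ = w' ≫ T.map A.proj) :
    A.app v (A.Tops.plus w w' (h.symm.trans h')) (by rw [FibreOps.plus_proj, h]) =
      (tOps A.E).plus (A.app v w h) (A.app v w' h') (by rw [A.app_p, A.app_p]) := by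
  have hw : A.Tops.plus w w' (h.symm.trans h') ≫ T.map A.lift ≫ c A.E =
      (tOps (T.obj A.E)).plus (w ≫ T.map A.lift ≫ c A.E) (w' ≫ T.map A.lift ≫ c A.E) (by
        simp only [Category.assoc, c_p, ← T.map_comp, A.lift_p]
        simp only [T.map_comp, ← Category.assoc, ← h, h']) := by
    rw [← Category.assoc, (A.lift_additive'.map T).plus, (c_additive A.E).plus]
    exact FibreOps.plus_congr _ (Category.assoc _ _ _) (Category.assoc _ _ _) _
  have hl := fun a b : Z ⟶ T.obj A.E => (tangentBundle A.E).lift_cancel (x := a) (y := b)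
  apply hl
  change _ ≫ l A.E = _ ≫ l A.E
  refine (A.app_l v _ _ (A.app_l_aux (by rw [FibreOps.plus_proj, h]))).trans ?_
  refine (A.Tapp_congr (zero_plus_zero v).symm hw _).trans ?_
  refine (A.Tapp_plus _ _ _ _ (A.app_l_aux h) (A.app_l_aux h') _ _).trans ?_
  refine (FibreOps.plus_congr _ (A.app_l v w h _).symm (A.app_l v w' h' _).symm _).trans ?_
  exact ((tangentBundle A.E).lift_additive'.plus _ _ _).symm

/-- `α(v + v', w +_p w') = α(v, w) +_{T(π)} α(v', w')`. -/
theorem app_plus_plus [HasSubstitution C] {Z : C} (v v' : Z ⟶ A.E) (w w' : Z ⟶ T.obj A.E)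
    (h : v ≫ A.ρ = w ≫ T.map A.proj) (h' : v' ≫ A.ρ = w' ≫ T.map A.proj)
    (k : v ≫ A.proj = v' ≫ A.proj) (k' : w ≫ p A.E = w' ≫ p A.E)
    (hs : A.ops.plus v v' k ≫ A.ρ = (tOps A.E).plus w w' k' ≫ T.map A.proj) :
    A.app (A.ops.plus v v' k) ((tOps A.E).plus w w' k') hs =
      A.Tops.plus (A.app v w h) (A.app v' w' h') (by
        rw [A.app_Tproj, A.app_Tproj, ← Category.assoc, k', Category.assoc]) := by
  have hT : A.app v w h ≫ T.map A.proj = A.app v' w' h' ≫ T.map A.proj := by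
    rw [A.app_Tproj, A.app_Tproj, ← Category.assoc, k', Category.assoc]
  apply A.Tlift_cancel
  have hc : ∀ {x y : Z ⟶ T.obj (T.obj A.E)}, x ≫ c A.E = y ≫ c A.E → x = y := by
    intro x y e
    simpa only [Category.assoc, c_c, Category.comp_id] using congrArg (· ≫ c A.E) e
  apply hc
  rw [Category.assoc, Category.assoc]
  refine (A.app_c _ _ hs (A.app_c_aux hs)).trans ?_
  refine (A.Tapp_congr (A.lift_additive'.plus _ _ _)
    ((tangentBundle A.E).lift_additive'.plus _ _ _) _).trans ?_
  refine (A.Tapp_plus _ _ _ _ (A.app_c_aux h) (A.app_c_aux h') _ _).trans ?_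
  refine (FibreOps.plus_congr _ (A.app_c v w h _).symm (A.app_c v' w' h' _).symm _).trans ?_
  rw [← Category.assoc (A.Tops.plus _ _ _), (A.lift_additive'.map T).plus, (c_additive A.E).plus]
  exact FibreOps.plus_congr _ (Category.assoc _ _ _).symm (Category.assoc _ _ _).symm _

section Scalars

variable [HasFiniteProducts C] [PreservesFiniteProducts (T : C ⥤ C)]

theorem TTprod_hom_ext {X Y Z : C} {x y : Z ⟶ T.obj (T.obj (X ⨯ Y))}
    (h₁ : x ≫ T.map (T.map prod.fst) = y ≫ T.map (T.map prod.fst))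
    (h₂ : x ≫ T.map (T.map prod.snd) = y ≫ T.map (T.map prod.snd)) : x = y := by
  rw [← cancel_mono (T.map (PreservesLimitPair.iso (T : C ⥤ C) X Y).hom)]
  apply Tprod_hom_ext
  · simpa only [Category.assoc, ← T.map_comp, PreservesLimitPair.iso_hom, prodComparison_fst]
  · simpa only [Category.assoc, ← T.map_comp, PreservesLimitPair.iso_hom, prodComparison_snd]

variable [HasSubstitution C] (U : PreUnitObject C)

theorem app_act_aux {Z : C} {v : Z ⟶ A.E} {w : Z ⟶ T.obj A.E}
    (h : v ≫ A.ρ = w ≫ T.map A.proj) (s : Z ⟶ T.obj U.R.E) :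
    v ≫ A.ρ = (prodT s w ≫ T.map (U.smul A.toDifferentialBundle)) ≫ T.map A.proj := by
  rw [Category.assoc, ← T.map_comp, (U.smul_spec _).proj, Category.id_comp, T.map_comp,
    ← Category.assoc, prodT_snd, h]

/-- `α(v, r •_{T(π)} w) = r •_p α(v, w)`, where `r •_{T(π)} w = T(•)(0r, w)`. -/
theorem app_act {Z : C} (r : Z ⟶ U.R.E) (v : Z ⟶ A.E) (w : Z ⟶ T.obj A.E)
    (h : v ≫ A.ρ = w ≫ T.map A.proj)
    (h' : v ≫ A.ρ = (prodT (r ≫ PreTangentCategory.zero U.R.E) w ≫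
      T.map (U.smul A.toDifferentialBundle)) ≫ T.map A.proj) :
    A.app v (prodT (r ≫ PreTangentCategory.zero U.R.E) w ≫
        T.map (U.smul A.toDifferentialBundle)) h' =
      U.act (tangentBundle A.E) r (A.app v w h) := by
  -- `g(r, (v, w)) = α(v, T(•)(0r, w))` is a linear extension of `α` along the unit point
  let S := U.smul A.toDifferentialBundle
  let L := pullback A.ρ (T.map A.proj)
  let w₀ : U.R.E ⨯ L ⟶ T.obj A.E := prodT (prod.fst ≫ PreTangentCategory.zero U.R.E)
    (prod.snd ≫ pullback.snd A.ρ (T.map A.proj)) ≫ T.map S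
  have h₀ : (prod.snd ≫ pullback.fst A.ρ (T.map A.proj) : U.R.E ⨯ L ⟶ A.E) ≫ A.ρ =
      w₀ ≫ T.map A.proj :=
    A.app_act_aux U (by rw [Category.assoc, pullback.condition, Category.assoc]) _
  let g : U.R.E ⨯ L ⟶ T.obj A.E := A.app (prod.snd ≫ pullback.fst A.ρ (T.map A.proj)) w₀ h₀
  have hlift : S ≫ A.lift = prodT (prod.fst ≫ U.R.lift)
      (prod.snd ≫ PreTangentCategory.zero A.E) ≫ T.map S :=
    (U.smul_spec A.toDifferentialBundle).linear
  have hg : IsScalarExtension U.R U.u (tangentBundle A.E) A.α g := by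
    refine ⟨?_, ?_, ?_⟩
    · change g ≫ p A.E = prod.snd ≫ A.α ≫ p A.E
      rw [A.app_p, A.α_p]
    · have e : A.app (pullback.fst A.ρ (T.map A.proj)) (pullback.snd A.ρ (T.map A.proj))
          pullback.condition = A.α := by
        rw [app]
        refine (congrArg (· ≫ A.α) ?_).trans (Category.id_comp _)
        apply pullback.hom_ext <;> simp
      refine (A.comp_app _ _ _ _).trans (Eq.trans ?_ e)
      refine A.app_congr (by rw [prod.lift_snd_assoc, Category.id_comp]) ?_ _
      have hu : pullback.snd A.ρ (T.map A.proj) ≫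
          T.map (prod.lift (terminal.from A.E ≫ U.u) (𝟙 A.E) ≫ S) =
            pullback.snd A.ρ (T.map A.proj) := by
        rw [(U.smul_spec A.toDifferentialBundle).unit, T.map_id, Category.comp_id]
      refine Eq.trans ?_ hu
      rw [T.map_comp, ← Category.assoc, ← Category.assoc, comp_prodT, comp_Tlift, T.map_id,
        Category.comp_id, prod.lift_fst_assoc, prod.lift_snd_assoc, Category.id_comp]
      congr 2
      rw [Category.assoc, zero_naturality, T.map_comp, ← Category.assoc, ← Category.assoc]
      congr 1
      exact (terminalIsTerminal.isTerminalObj (T : C ⥤ C)).hom_ext _ _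
    · refine (A.app_l _ _ h₀ (A.app_l_aux h₀)).trans ?_
      refine Eq.trans ?_ (A.comp_Tmap_app _ _ _ h₀).symm
      refine A.Tapp_congr ?_ ?_ _
      · rw [T.map_comp, ← Category.assoc (prodT _ _), prodT_snd, Category.assoc, Category.assoc,
          zero_naturality]
      · have hflip : prodT (prod.fst ≫ PreTangentCategory.zero U.R.E)
            (prod.snd ≫ pullback.snd A.ρ (T.map A.proj)) ≫
            T.map (prodT (prod.fst ≫ U.R.lift) (prod.snd ≫ PreTangentCategory.zero A.E)) ≫
              c (U.R.E ⨯ A.E) =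
          prodT (prod.fst ≫ U.R.lift) (prod.snd ≫ PreTangentCategory.zero L) ≫
            T.map (prodT (prod.fst ≫ PreTangentCategory.zero U.R.E)
              (prod.snd ≫ pullback.snd A.ρ (T.map A.proj))) := by
          -- `c` exchanges the two zero sections `0` and `T(0)`
          have hc : ∀ N : C, PreTangentCategory.zero (T.obj N) ≫ c N =
              T.map (PreTangentCategory.zero N) := by
            intro N
            rw [← T_zero_c, Category.assoc, c_c, Category.comp_id]
          apply TTprod_hom_ext
          · simp only [Category.assoc]
            rw [← c_naturality, ← T.map_comp_assoc, ← T.map_comp, prodT_fst, prodT_fst,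
              T.map_comp, T.map_comp, ← Category.assoc, ← Category.assoc, prodT_fst,
              ← Category.assoc (prodT _ _) (T.map prod.fst), prodT_fst]
            simp only [Category.assoc]
            rw [← Category.assoc (PreTangentCategory.zero U.R.E), ← zero_naturality,
              Category.assoc, hc]
          · simp only [Category.assoc]
            rw [← c_naturality, ← T.map_comp_assoc, ← T.map_comp, prodT_snd, prodT_snd,
              T.map_comp, T.map_comp, ← Category.assoc, ← Category.assoc, prodT_snd,
              ← Category.assoc (prodT _ _) (T.map prod.snd), prodT_snd]
            simp only [Category.assoc]
            rw [T_zero_c, zero_naturality]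
        rw [T.map_comp, ← Category.assoc (prodT (prod.fst ≫ U.R.lift) _), ← hflip]
        simp only [Category.assoc, w₀]
        rw [← c_naturality, ← T.map_comp_assoc, hlift, T.map_comp, Category.assoc]
  have e := U.lift_scalarExtension hg r (pullback.lift v w h)
  refine Eq.trans ?_ e
  refine Eq.trans ?_ (A.comp_app _ _ _ h₀).symm
  refine A.app_congr ?_ ?_ _
  · rw [prod.lift_snd_assoc, pullback.lift_fst]
  · rw [← Category.assoc, comp_prodT, prod.lift_fst_assoc, prod.lift_snd_assoc,
      pullback.lift_snd]

end Scalars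

end PreInvolutionAlgebroid

end Algebroid

/-! ### The Leibniz law -/

section Leibniz

open PreTangentCategory

variable {C : Type u} [Category.{v} C] [TangentCategory C] {M : C}

theorem Sec.ext {A : DifferentialBundle M} {X Y : Sec A} (h : X.map = Y.map) : X = Y := by
  cases X; cases Y; cases h; rfl

namespace InvolutionAlgebroid

variable {A : InvolutionAlgebroid M} (X Y : A.Section)

theorem section_ρ_Tξ_p : (X.map ≫ A.ρ ≫ T.map A.ξ) ≫ p A.E = A.ξ := by
  simp only [Category.assoc, p_naturality]
  rw [← Category.assoc A.ρ, A.ρ_p, ← Category.assoc, X.w, Category.id_comp]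

theorem sec_lift_p (Z : A.Section) : (Z.map ≫ A.lift) ≫ p A.E = A.ξ := by
  rw [Category.assoc, A.lift_p, ← Category.assoc, Z.w, Category.id_comp]

theorem sec_lift_Tproj (Z : A.Section) :
    (Z.map ≫ A.lift) ≫ T.map A.proj = PreTangentCategory.zero M := by
  rw [Category.assoc, A.lift_Tproj, ← Category.assoc, Z.w, Category.id_comp]

theorem sec_zero_Tproj (Z : A.Section) :
    (Z.map ≫ PreTangentCategory.zero A.E) ≫ T.map A.proj = PreTangentCategory.zero M := by
  rw [Category.assoc, ← zero_naturality, ← Category.assoc, Z.w, Category.id_comp]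

theorem lift_plus_zero_p (W X : A.Section) (h : (W.map ≫ A.lift) ≫ T.map A.proj =
      (X.map ≫ PreTangentCategory.zero A.E) ≫ T.map A.proj) :
    A.Tops.plus (W.map ≫ A.lift) (X.map ≫ PreTangentCategory.zero A.E) h ≫ p A.E = X.map := by
  rw [map_plus_p]
  have e := A.bundle.zero_plus X.map
  refine (FibreOps.plus_congr _ ?_ ?_ _).trans e
  · rw [sec_lift_p, ← Category.assoc, X.w, Category.id_comp]
  · rw [Category.assoc, zero_p, Category.comp_id]

theorem section_ρ_eq : X.map ≫ A.ρ = (X.map ≫ A.ρ ≫ T.map A.ξ) ≫ T.map A.proj := by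
  simp only [Category.assoc, ← T.map_comp, A.ξ_proj, T.map_id, Category.comp_id]

theorem lift_zero_Tproj (W X : A.Section) : (W.map ≫ A.lift) ≫ T.map A.proj =
    (X.map ≫ PreTangentCategory.zero A.E) ≫ T.map A.proj := by
  rw [sec_lift_Tproj, sec_zero_Tproj]

/-- The bracket is the vertical part of `α(X, T(Y) ρ X) -_p T(X) ρ Y`. -/
theorem transfer_minus_deriv (h : transfer X Y ≫ p A.E = deriv Y X ≫ p A.E)
    (k : ((bracket X Y).map ≫ A.lift) ≫ T.map A.proj =
      (X.map ≫ PreTangentCategory.zero A.E) ≫ T.map A.proj) :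
    (tOps A.E).minus (transfer X Y) (deriv Y X) h =
    A.Tops.plus ((bracket X Y).map ≫ A.lift) (X.map ≫ PreTangentCategory.zero A.E) k := by
  have hT : (tOps A.E).minus (transfer X Y) (deriv Y X) h ≫ T.map A.proj =
      (deriv Y X ≫ p A.E ≫ PreTangentCategory.zero A.E) ≫ T.map A.proj := by
    rw [tOps_minus_map _ _ _ _ (by rw [transfer_Tproj, deriv_Tproj]), Category.assoc,
      Category.assoc, ← zero_naturality]
  refine ((A.bundle.map_minus_plus_cancel T _ _ hT).symm).trans ?_
  refine FibreOps.plus_congr _ (bracket_lift X Y).symm ?_ _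
  rw [← Category.assoc, deriv_p]

variable [HasFiniteProducts C] [PreservesFiniteProducts (T : C ⥤ C)] [HasSubstitution C]
  (U : UnitObject C) (ψ : M ⟶ U.R.E)

/-- `T(ψ • Y) ρ X = T(•)(0ψ, T(Y) ρ X) +_{T(π)} (λ(L_{ρX}(ψ) • Y) +_p T(ξ) ρ X)`. -/
theorem deriv_smulSec
    (k : ((U.smulSec (U.lieDeriv X ψ) Y).map ≫ A.lift) ≫ p A.E =
      (X.map ≫ A.ρ ≫ T.map A.ξ) ≫ p A.E)
    (h : (prodT (ψ ≫ PreTangentCategory.zero U.R.E) (deriv X Y) ≫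
        T.map (U.smul A.toDifferentialBundle)) ≫ T.map A.proj =
      (tOps A.E).plus ((U.smulSec (U.lieDeriv X ψ) Y).map ≫ A.lift)
        (X.map ≫ A.ρ ≫ T.map A.ξ) k ≫ T.map A.proj) :
    deriv X (U.smulSec ψ Y) = A.Tops.plus
      (prodT (ψ ≫ PreTangentCategory.zero U.R.E) (deriv X Y) ≫
        T.map (U.smul A.toDifferentialBundle))
      ((tOps A.E).plus ((U.smulSec (U.lieDeriv X ψ) Y).map ≫ A.lift)
        (X.map ≫ A.ρ ≫ T.map A.ξ) k) h := by
  have e : deriv X (U.smulSec ψ Y) = prodT (X.map ≫ A.ρ ≫ T.map ψ) (deriv X Y) ≫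
      T.map (U.smul A.toDifferentialBundle) := by
    change X.map ≫ A.ρ ≫ T.map (prod.lift ψ Y.map ≫ _) = _
    rw [T.map_comp, ← Category.assoc A.ρ, ← Category.assoc, ← Category.assoc X.map A.ρ, comp_Tlift]
    simp only [Category.assoc]
    rfl
  have hψ : (X.map ≫ A.ρ ≫ T.map ψ) ≫ p U.R.E = ψ := by
    simp only [Category.assoc, p_naturality]
    rw [← Category.assoc A.ρ, A.ρ_p, ← Category.assoc, X.w, Category.id_comp]
  have hd := phat_decomposition U.R (X.map ≫ A.ρ ≫ T.map ψ)
  have hL : (X.map ≫ A.ρ ≫ T.map ψ) ≫ phat U.R = U.lieDeriv X ψ := by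
    simp only [Category.assoc]
    rfl
  have ht := U.torsion_free A.toDifferentialBundle (U.lieDeriv X ψ) (deriv X Y)
  have h₁ : (prodT (ψ ≫ PreTangentCategory.zero U.R.E) (deriv X Y) ≫
        T.map (U.smul A.toDifferentialBundle)) ≫ T.map A.proj =
      (prodT (U.lieDeriv X ψ ≫ U.R.lift) (deriv X Y) ≫
        T.map (U.smul A.toDifferentialBundle)) ≫ T.map A.proj :=
    (A.app_act_aux U.toPreUnitObject (deriv_Tproj X Y) _).symm.trans
      (A.app_act_aux U.toPreUnitObject (deriv_Tproj X Y) _)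
  have hterm : (ψ ≫ PreTangentCategory.zero U.R.E) ≫ T.map U.R.proj =
      (U.lieDeriv X ψ ≫ U.R.lift) ≫ T.map U.R.proj :=
    (terminalIsTerminal.isTerminalObj (T : C ⥤ C)).hom_ext _ _
  have hsum : X.map ≫ A.ρ ≫ T.map ψ = U.R.Tops.plus (ψ ≫ PreTangentCategory.zero U.R.E)
      (U.lieDeriv X ψ ≫ U.R.lift) hterm := by
    refine hd.symm.trans (FibreOps.plus_congr _ ?_ (by rw [hL]) _)
    rw [← Category.assoc, hψ]
  rw [e, hsum, U.prodT_plus_smul _ _ _ _ _ h₁]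
  refine FibreOps.plus_congr _ rfl (ht.trans (FibreOps.plus_congr _ ?_ ?_ _)) _
  · change _ = U.act _ _ Y.map ≫ _
    rw [deriv_p]
  · rw [T.map_comp, ← Category.assoc, ← deriv_Tproj, Category.assoc]

/-- `α(X, T(ψ • Y) ρ X) = ψ •_p α(X, T(Y) ρ X) +_p (λ(L_{ρX}(ψ) • Y) +_{T(π)} 0X)`. -/
theorem transfer_smulSec
    (h : ((U.smulSec (U.lieDeriv X ψ) Y).map ≫ A.lift) ≫ T.map A.proj =
      (X.map ≫ PreTangentCategory.zero A.E) ≫ T.map A.proj)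
    (k : U.act (tangentBundle A.E) ψ (transfer X Y) ≫ p A.E =
      A.Tops.plus ((U.smulSec (U.lieDeriv X ψ) Y).map ≫ A.lift)
        (X.map ≫ PreTangentCategory.zero A.E) h ≫ p A.E) :
    transfer X (U.smulSec ψ Y) = (tOps A.E).plus
      (U.act (tangentBundle A.E) ψ (transfer X Y))
      (A.Tops.plus ((U.smulSec (U.lieDeriv X ψ) Y).map ≫ A.lift)
        (X.map ≫ PreTangentCategory.zero A.E) h) k := by
  set W := U.smulSec (U.lieDeriv X ψ) Y
  have kW : (W.map ≫ A.lift) ≫ p A.E = (X.map ≫ A.ρ ≫ T.map A.ξ) ≫ p A.E := by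
    rw [sec_lift_p, section_ρ_Tξ_p]
  have hξ : (A.ξ : M ⟶ A.E) ≫ A.ρ = (W.map ≫ A.lift) ≫ T.map A.proj := by
    rw [A.ξ_ρ, sec_lift_Tproj]
  -- `X` is split as `ξ + X`, to match the sum `λ(L • Y) +_p T(ξ) ρ X`
  have hv : A.ops.plus A.ξ X.map (by rw [A.ξ_proj, X.w]) = X.map := by
    refine (FibreOps.plus_congr _ ?_ rfl _).trans (A.bundle.zero_plus X.map)
    rw [← Category.assoc, X.w, Category.id_comp]
  have h₂ : X.map ≫ A.ρ = (tOps A.E).plus (W.map ≫ A.lift) (X.map ≫ A.ρ ≫ T.map A.ξ) kW ≫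
      T.map A.proj := by
    rw [plus_Tmap]
    have e := (bundle M).zero_plus (X.map ≫ A.ρ)
    refine (Eq.trans (FibreOps.plus_congr _ ?_ ?_ _) e).symm
    · rw [sec_lift_Tproj, bundle_zero, Category.assoc, ← Category.assoc A.ρ, A.ρ_p,
        ← Category.assoc, X.w, Category.id_comp]
    · exact (section_ρ_eq X).symm
  have h₁ := A.app_act_aux U.toPreUnitObject (deriv_Tproj X Y) (ψ ≫ PreTangentCategory.zero U.R.E)
  have e₂ : A.app X.map ((tOps A.E).plus (W.map ≫ A.lift) (X.map ≫ A.ρ ≫ T.map A.ξ) kW) h₂ =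
      A.Tops.plus (W.map ≫ A.lift) (X.map ≫ PreTangentCategory.zero A.E) h := by
    refine (A.app_congr hv.symm rfl h₂).trans ?_
    refine (A.app_plus_plus A.ξ X.map _ _ hξ (section_ρ_eq X) _ kW _).trans ?_
    refine FibreOps.plus_congr _ ?_ (A.app_Tξ X.map (section_ρ_eq X)) _
    have hu := congrArg (W.map ≫ ·) A.unit
    refine Eq.trans ?_ hu
    refine Eq.trans ?_ (A.comp_app _ _ _ _).symm
    refine A.app_congr ?_ rfl _
    rw [← Category.assoc, W.w, Category.id_comp]
  refine (A.app_congr rfl (deriv_smulSec X Y U ψ kW (h₁.symm.trans h₂)) _).trans ?_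
  refine (A.app_plus_right X.map _ _ h₁ h₂).trans ?_
  exact FibreOps.plus_congr _ (A.app_act U.toPreUnitObject ψ X.map _ (deriv_Tproj X Y) h₁) e₂ _

theorem act_transfer_Tproj :
    U.act (tangentBundle A.E) ψ (transfer X Y) ≫ T.map A.proj = (U.smulSec ψ Y).map ≫ A.ρ := by
  refine (U.act_comp_linear (Tmap_linear A.proj) ψ (transfer X Y)).trans ?_
  refine Eq.trans ?_ (U.act_comp_linear A.ρ_linear ψ Y.map).symm
  exact U.act_congr _ rfl (transfer_Tproj X Y)

theorem act_transfer_p : U.act (tangentBundle A.E) ψ (transfer X Y) ≫ p A.E = X.map :=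
  (U.act_proj (tangentBundle A.E) ψ (transfer X Y)).trans (transfer_p X Y)

/-- The equation for `α(X, T(ψ • Y) ρ X) -_{T(π)} ψ •_p α(X, T(Y) ρ X)`. With `b` the second term and
`k = λ(L_{ρX}(ψ) • Y)`, the first is
`b +_p (k +_{T(π)} 0X) = (T(ξπ)b +_{T(π)} b) +_p (k +_{T(π)} 0X) = (T(ξπ)b +_p k) +_{T(π)} b` by the
interchange law. -/
theorem transfer_minus_act
    (h : transfer X (U.smulSec ψ Y) ≫ T.map A.proj =
      U.act (tangentBundle A.E) ψ (transfer X Y) ≫ T.map A.proj)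
    (h' : ((U.smulSec (U.lieDeriv X ψ) Y).map ≫ A.lift) ≫ p A.E =
      ((U.smulSec ψ Y).map ≫ A.ρ ≫ T.map A.ξ) ≫ p A.E) :
    A.Tops.minus (transfer X (U.smulSec ψ Y))
        (U.act (tangentBundle A.E) ψ (transfer X Y)) h =
      (tOps A.E).plus ((U.smulSec (U.lieDeriv X ψ) Y).map ≫ A.lift)
        ((U.smulSec ψ Y).map ≫ A.ρ ≫ T.map A.ξ) h' := by
  set W := U.smulSec (U.lieDeriv X ψ) Y
  set b : M ⟶ T.obj A.E := U.act (tangentBundle A.E) ψ (transfer X Y)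
  have hb : b ≫ T.map A.proj = (U.smulSec ψ Y).map ≫ A.ρ := act_transfer_Tproj X Y U ψ
  have hbp : b ≫ p A.E = X.map := act_transfer_p X Y U ψ
  set z : M ⟶ T.obj A.E := (U.smulSec ψ Y).map ≫ A.ρ ≫ T.map A.ξ
  have hzb : z ≫ T.map A.proj = b ≫ T.map A.proj := by
    rw [hb]
    exact (section_ρ_eq _).symm
  -- `z = T(ξπ)(b)` and `0X = 0p(b)` are the neutral elements of the two fibres that contain `b`
  have hz : A.Tops.plus z b hzb = b := by
    have e := A.bundle.map_plus_zero T b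
    rw [A.bundle.map_plus_comm T] at e
    refine (FibreOps.plus_congr _ ?_ rfl _).trans e
    rw [T.map_comp, ← Category.assoc, hb, Category.assoc]
  have hX : (bundle A.E).toFibreOps.plus b (X.map ≫ PreTangentCategory.zero A.E)
      (by rw [hbp, Category.assoc, zero_p, Category.comp_id]) = b := by
    refine (FibreOps.plus_congr _ rfl ?_ _).trans ((bundle A.E).plus_zero b)
    rw [← Category.assoc, bundle_zero]
    exact congrArg (· ≫ _) hbp.symm
  have hzp : z ≫ p A.E = (W.map ≫ A.lift) ≫ p A.E := by rw [sec_lift_p]; exact section_ρ_Tξ_p _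
  have hbp' : b ≫ p A.E = (X.map ≫ PreTangentCategory.zero A.E) ≫ p A.E := by
    rw [hbp, Category.assoc, zero_p, Category.comp_id]
  have hi := interchange A.ops z b (W.map ≫ A.lift) (X.map ≫ PreTangentCategory.zero A.E) hzb
    (lift_zero_Tproj W X) hzp hbp'
  have hs : (tOps A.E).plus (W.map ≫ A.lift) z hzp.symm ≫ T.map A.proj = b ≫ T.map A.proj := by
    rw [plus_Tmap, ← hzb]
    refine (FibreOps.plus_congr _ ?_ rfl _).trans ((bundle M).zero_plus (z ≫ T.map A.proj))
    have e : ∀ x : M ⟶ T.obj A.E, x ≫ p A.E = A.ξ →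
        (x ≫ T.map A.proj) ≫ p M ≫ PreTangentCategory.zero M = PreTangentCategory.zero M := by
      intro x hx
      rw [Category.assoc, ← Category.assoc (T.map A.proj), p_naturality, Category.assoc,
        ← Category.assoc x, hx, ← Category.assoc, A.ξ_proj, Category.id_comp]
    rw [sec_lift_Tproj, bundle_zero]
    exact (e z (section_ρ_Tξ_p _)).symm
  have ha : transfer X (U.smulSec ψ Y) =
      A.Tops.plus ((tOps A.E).plus (W.map ≫ A.lift) z hzp.symm) b hs := by
    refine (transfer_smulSec X Y U ψ (lift_zero_Tproj W X)
      (by rw [lift_plus_zero_p]; exact hbp)).trans ?_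
    refine (FibreOps.plus_congr _ hz.symm rfl _).trans (hi.trans ?_)
    exact FibreOps.plus_congr _ ((bundle A.E).plus_comm _ _ _) hX _
  refine (FibreOps.minus_congr _ ha rfl _).trans ?_
  exact A.bundle.map_plus_minus_cancel T _ _ _

theorem deriv_smulSec_left :
    deriv (U.smulSec ψ Y) X = U.act (tangentBundle A.E) ψ (deriv Y X) := by
  have e₁ : (U.smulSec ψ Y).map ≫ A.ρ = U.act (tangentBundle M) ψ (Y.map ≫ A.ρ) :=
    U.act_comp_linear A.ρ_linear ψ Y.map
  rw [deriv, ← Category.assoc, e₁]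
  refine (U.act_comp_linear (Tmap_linear X.map) ψ (Y.map ≫ A.ρ)).trans ?_
  exact U.act_congr _ rfl (Category.assoc _ _ _)

/-- The Leibniz law. Both summands of `λ[X, ψ • Y] +_{T(π)} 0X`, expanded as
`ψ •_p (λ[X, Y] +_{T(π)} 0X) +_p (λ(L_{ρX}(ψ) • Y) +_{T(π)} 0X)`, are of the form `λ(-) +_{T(π)} 0X`,
and the interchange law adds them. -/
theorem bracket_smulSec : bracket X (U.smulSec ψ Y) =
    U.smulSec ψ (bracket X Y) + U.smulSec (U.lieDeriv X ψ) Y := by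
  apply Sec.ext
  apply A.lift_cancel
  set W := U.smulSec (U.lieDeriv X ψ) Y
  set V := U.smulSec ψ (bracket X Y)
  set z : M ⟶ T.obj A.E := X.map ≫ PreTangentCategory.zero A.E
  have hp : transfer X Y ≫ p A.E = deriv Y X ≫ p A.E := by rw [transfer_p, deriv_p]
  have hW := lift_zero_Tproj W X
  have hV := lift_zero_Tproj V X
  have k₁ : U.act (tangentBundle A.E) ψ (transfer X Y) ≫ p A.E =
      A.Tops.plus (W.map ≫ A.lift) z hW ≫ p A.E := by
    rw [lift_plus_zero_p]; exact act_transfer_p X Y U ψ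
  have k₂ : U.act (tangentBundle A.E) ψ (transfer X Y) ≫ p A.E =
      U.act (tangentBundle A.E) ψ (deriv Y X) ≫ p A.E :=
    (act_transfer_p X Y U ψ).trans
      ((U.act_proj (tangentBundle A.E) ψ (deriv Y X)).trans (deriv_p Y X)).symm
  have hact : (tOps A.E).minus (U.act (tangentBundle A.E) ψ (transfer X Y))
      (U.act (tangentBundle A.E) ψ (deriv Y X)) k₂ = A.Tops.plus (V.map ≫ A.lift) z hV := by
    refine (U.act_minus_right (tangentBundle A.E) ψ _ _ hp).symm.trans ?_
    refine (U.act_congr _ rfl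
      (transfer_minus_deriv X Y hp (lift_zero_Tproj (bracket X Y) X))).trans ?_
    exact U.act_zero_plus_lift A.toDifferentialBundle ψ X.map (bracket X Y).map _ hV
  have hVW : V.map ≫ A.proj = W.map ≫ A.proj := by rw [V.w, W.w]
  have hzz : (tOps A.E).plus z z rfl = z := zero_plus_zero X.map
  have kVW : (V.map ≫ A.lift) ≫ p A.E = (W.map ≫ A.lift) ≫ p A.E := by
    rw [sec_lift_p, sec_lift_p]
  have hsum := lift_zero_Tproj (V + W) X
  have hsum' : (V + W).map ≫ A.lift = (tOps A.E).plus (V.map ≫ A.lift) (W.map ≫ A.lift) kVW :=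
    A.lift_additive'.plus V.map W.map hVW
  have hfin : A.Tops.plus ((V + W).map ≫ A.lift) z hsum =
      (tOps A.E).minus (transfer X (U.smulSec ψ Y)) (deriv (U.smulSec ψ Y) X)
        (by rw [transfer_p, deriv_p]) := by
    symm
    refine (FibreOps.minus_congr _ (transfer_smulSec X Y U ψ hW k₁)
      (deriv_smulSec_left X Y U ψ) _).trans ?_
    refine ((bundle A.E).plus_minus_right_comm _ _ _ k₁ k₂).trans ?_
    refine (FibreOps.plus_congr _ hact rfl _).trans ?_
    refine (interchange A.ops _ _ _ _ hV hW kVW rfl).trans ?_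
    exact FibreOps.plus_congr _ hsum'.symm hzz _
  rw [bracket_lift, DifferentialBundle.rawDiff]
  refine (FibreOps.minus_congr _ hfin.symm ?_ _).trans
    (A.bundle.map_plus_minus_cancel T _ _ hsum)
  rw [← Category.assoc, deriv_p]

end InvolutionAlgebroid

end Leibniz

end TangentCat

theorem mainTheorem2 {C : Type u} [Category.{v} C] [TangentCat.TangentCategory C]
    [HasFiniteProducts C]
    [PreservesFiniteProducts (TangentCat.PreTangentCategory.T : C ⥤ C)]
    [TangentCat.HasSubstitution C] (U : TangentCat.UnitObject C) {M : C}
    (A : TangentCat.InvolutionAlgebroid M) (X Y : A.Section) (ψ : M ⟶ U.R.E) :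
    -- the Leibniz law `[X, ψ • Y] = ψ • [X, Y] + L_{ρX}(ψ) • Y`
    TangentCat.InvolutionAlgebroid.bracket X (U.smulSec ψ Y) =
        U.smulSec ψ (TangentCat.InvolutionAlgebroid.bracket X Y) +
          U.smulSec (U.lieDeriv X ψ) Y ∧
      -- `α(X, T(ψ • Y) ρ X) -_{T(π)} ψ •_p α(X, T(Y) ρ X)
      --    = λ(L_{ρX}(ψ) • Y) +_p T(ξ) ρ (ψ • Y)`, both sides being well defined
      ∃ (h : TangentCat.InvolutionAlgebroid.transfer X (U.smulSec ψ Y) ≫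
              TangentCat.PreTangentCategory.T.map A.proj =
            U.act (TangentCat.tangentBundle A.E) ψ
                (TangentCat.InvolutionAlgebroid.transfer X Y) ≫
              TangentCat.PreTangentCategory.T.map A.proj)
        (h' : ((U.smulSec (U.lieDeriv X ψ) Y).map ≫ A.lift) ≫
              TangentCat.PreTangentCategory.p A.E =
            ((U.smulSec ψ Y).map ≫ A.ρ ≫ TangentCat.PreTangentCategory.T.map A.ξ) ≫
              TangentCat.PreTangentCategory.p A.E),
        A.Tops.minus (TangentCat.InvolutionAlgebroid.transfer X (U.smulSec ψ Y))
            (U.act (TangentCat.tangentBundle A.E) ψ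
              (TangentCat.InvolutionAlgebroid.transfer X Y)) h =
          (TangentCat.tOps A.E).plus ((U.smulSec (U.lieDeriv X ψ) Y).map ≫ A.lift)
            ((U.smulSec ψ Y).map ≫ A.ρ ≫ TangentCat.PreTangentCategory.T.map A.ξ) h' := by
  refine ⟨TangentCat.InvolutionAlgebroid.bracket_smulSec X Y U ψ, ?_, ?_, ?_⟩
  · rw [TangentCat.InvolutionAlgebroid.transfer_Tproj,
      TangentCat.InvolutionAlgebroid.act_transfer_Tproj]
  · rw [TangentCat.InvolutionAlgebroid.sec_lift_p, TangentCat.InvolutionAlgebroid.section_ρ_Tξ_p]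
  · exact TangentCat.InvolutionAlgebroid.transfer_minus_act X Y U ψ _ _
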